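/- **Setting.** Let $\mathcal X$ (latent states) and $\mathcal A$ (actions) be finite, $X=|\mathcal X|$, $A=|\mathcal A|$, and let $\mathcal Y$ (observations) be a measurable space with a $\sigma$-finite reference measure $\nu$ (possibly infinite; counting measure if $\mathcal Y$ is finite). An emission function is a map $O:\mathcal X\to\Delta(\mathcal Y)$ into the probability densities with respect to $\nu$. A POMDP with horizon $H\ge 1$ has a known initial distribution $\rho\in\Delta(\mathcal X)$, a transition function $T_\star:\mathcal X\times\mathcal A\to\Delta(\mathcal X)$, an emission function $O_\star$ and a known reward $r:\mathcal X\times\mathcal A\to[0,1]$. An episode run with a history-dependent policy $\pi$ draws $x_1\sim\rho$ and, for $h=1,\dots,H$, $y_h\sim O_\star(\cdot\mid x_h)$, $a_h\sim\pi(\cdot\mid y_{1:h},a_{1:h-1})$, $x_{h+1}\sim T_\star(\cdot\mid x_h,a_h)$. Its value is $v(\pi)=\mathbb E_\pi\big[\sum_{h=1}^H r(x_h,a_h)\big]$; $\pi^\star$ denotes a history-dependent policy maximizing $v$. There are $K\ge1$ episodes; the policy $\hat\pi_k$ of episode $k$ may depend on the full trajectories $(x^\ell_{1:H+1},y^\ell_{1:H},a^\ell_{1:H})$,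 $\ell<k$, latent states included (hindsight observability). The regret is $\operatorname{Reg}(K)=\sum_{k=1}^K\big(v(\pi^\star)-v(\hat\pi_k)\big)$. **Algorithm (HOP-B with emission class $\Theta$).** Let $\Theta$ be a finite class of emission functions with $O_\star\in\Theta$, and let $\delta\in(0,1)$. A planner $\mathsf{POP}$ returns, for given $(T,O,r)$, a history-dependent policy that is optimal in the POMDP $(\rho,T,O,r)$. The initial models $\hat T_1,\hat O_1$ are arbitrary. In round $k$ let $n_k(x)$ and $n_k(x,a)$ be the numbers of pairs $(\ell,h)$ with $\ell<k$, $1\le h\le H$ and $x^\ell_h=x$, respectively $(x^\ell_h,a^\ell_h)=(x,a)$. For $k\ge2$ let $\hat T_k(x'\mid x,a)$ be the fraction of these $n_k(x,a)$ visits with $x^\ell_{h+1}=x'$ (equal to $\hat T_1(x'\mid x,a)$ if $n_k(x,a)=0$), and let $$\hat O_k\in\operatorname*{arg\,max}_{O\in\Theta}\ \sum_{\ell<k,\ h\le H}\log O(y^\ell_h\mid x^\ell_h),\qquad \log 0=-\infty,$$ with a measurable choice of the maximizer. With $$\epsilon_k(x,a)=\min\Big\{2,\sqrt{\tfrac{8X\log(X^2AKH/\delta)}{n_k(x,a)}}\Big\},\qquad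 \epsilon_k(x)=\min\Big\{2,\sqrt{\tfrac{8\log(|\Theta|XK/\delta)}{n_k(x)}}\Big\}$$ (equal to $2$ when the count is $0$) and $\hat r_k(x,a)=r(x,a)+3H\epsilon_k(x,a)+H\epsilon_k(x)$, the algorithm deploys $\hat\pi_k=\mathsf{POP}(\hat T_k,\hat O_k,\hat r_k)$. **Proposition.** There is a universal constant $C>0$ such that in this setting, for all $X,A,H,K,\mathcal Y,\nu,\Theta,\delta$ and every choice of the remaining data, with probability at least $1-3\delta$, $$\operatorname{Reg}(K)\ \le\ C\left(\sqrt{H^5XK\,(\log|\Theta|+\iota)}+\sqrt{H^5X^2AK\,\iota}\right),\qquad \iota=\log\frac{2X^2AKH}{\delta}.$$ -/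

import Mathlib

open MeasureTheory
open scoped ENNReal NNReal

noncomputable section

namespace HOMDP

/-- Conditional emission densities `O(· | x)` with respect to the reference measure `ν` on the
observation space: for every latent state `x` a probability density. When observations are
finite or countable one takes `ν` to be the counting measure. -/
structure Emission (𝒳 : Type*) {𝒴 : Type*} [MeasurableSpace 𝒴] (ν : Measure 𝒴) where
  density : 𝒳 → 𝒴 → ℝ≥0
  measurable_density : ∀ x, Measurable (density x)
  lintegral_density : ∀ x, ∫⁻ y, (density x y : ℝ≥0∞) ∂ν = 1

/-- A POMDP: initial distribution, latent transitions, emissions and reward function. -/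
structure POMDP (𝒳 𝒜 : Type*) {𝒴 : Type*} [MeasurableSpace 𝒴] (ν : Measure 𝒴) where
  init : PMF 𝒳
  trans : 𝒳 → 𝒜 → PMF 𝒳
  emit : Emission 𝒳 ν
  reward : 𝒳 → 𝒜 → ℝ

/-- A history-dependent policy for episodes of length `H`. At (zero-based) step `h` it maps the
observations `y_0, …, y_h` and the actions `a_0, …, a_{h-1}` to a distribution over actions. -/
structure Policy (𝒴 𝒜 : Type*) [MeasurableSpace 𝒴] (H : ℕ) where
  act : (h : Fin H) → (Fin (h + 1) → 𝒴) → (Fin h → 𝒜) → PMF 𝒜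
  measurable_act : ∀ h as a, Measurable fun ys => act h ys as a

/-- A full trajectory: `H + 1` latent states, `H` observations, `H` actions. -/
abbrev Traj (𝒳 𝒴 𝒜 : Type*) (H : ℕ) : Type _ :=
  (Fin (H + 1) → 𝒳) × (Fin H → 𝒴) × (Fin H → 𝒜)

section Model

variable {𝒳 𝒴 𝒜 : Type*} [MeasurableSpace 𝒳] [MeasurableSpace 𝒴] [MeasurableSpace 𝒜]
  {ν : Measure 𝒴} {H : ℕ}

/-- The reference measure on trajectories: counting measure on latent states and on actions,
`ν` on each observation. -/
def trajRef (ν : Measure 𝒴) : Measure (Traj 𝒳 𝒴 𝒜 H) :=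
  (Measure.count : Measure (Fin (H + 1) → 𝒳)).prod
    ((Measure.pi fun _ : Fin H => ν).prod (Measure.count : Measure (Fin H → 𝒜)))

/-- The density of the trajectory generated by `x_0 ∼ ρ` and, for each step `h`,
`y_h ∼ O(· | x_h)`, `a_h ∼ π(· | y_{0:h}, a_{0:h-1})`, `x_{h+1} ∼ T(· | x_h, a_h)`. -/
def trajDensity (M : POMDP 𝒳 𝒜 ν) (π : Policy 𝒴 𝒜 H) (τ : Traj 𝒳 𝒴 𝒜 H) : ℝ≥0∞ :=
  M.init (τ.1 0) *
    ∏ h : Fin H,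
      ((M.emit.density (τ.1 h.castSucc) (τ.2.1 h) : ℝ≥0∞) *
        π.act h (fun i => τ.2.1 (Fin.castLE h.isLt i))
          (fun i => τ.2.2 (Fin.castLE h.isLt.le i)) (τ.2.2 h) *
        M.trans (τ.1 h.castSucc) (τ.2.2 h) (τ.1 h.succ))

/-- The law of the trajectory of one episode when policy `π` is run in the model `M`. -/
def trajLaw (M : POMDP 𝒳 𝒜 ν) (π : Policy 𝒴 𝒜 H) : Measure (Traj 𝒳 𝒴 𝒜 H) :=
  (trajRef ν).withDensity (trajDensity M π)

/-- The value `v(π)`: the expected cumulative reward of an episode. -/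
def value (M : POMDP 𝒳 𝒜 ν) (π : Policy 𝒴 𝒜 H) : ℝ :=
  ∫ τ, ∑ h : Fin H, M.reward (τ.1 h.castSucc) (τ.2.2 h) ∂(trajLaw M π)

/-- `π` maximizes the value among all history-dependent policies. -/
def IsOptimal (M : POMDP 𝒳 𝒜 ν) (π : Policy 𝒴 𝒜 H) : Prop :=
  ∀ π' : Policy 𝒴 𝒜 H, value M π' ≤ value M π

/-- A POMDP planner: given transitions, emissions and rewards, it returns an optimal
history-dependent policy of the resulting model (with known initial distribution `ρ`). -/
def IsPlanner (ρ : PMF 𝒳)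
    (POP : (𝒳 → 𝒜 → PMF 𝒳) → Emission 𝒳 ν → (𝒳 → 𝒜 → ℝ) → Policy 𝒴 𝒜 H) : Prop :=
  ∀ T O r, IsOptimal ⟨ρ, T, O, r⟩ (POP T O r)

/-- A learner in the hindsight observable protocol: before (zero-based) round `k` it picks a policy
from the `k` full trajectories (latent states included) of the previous rounds. -/
abbrev Learner (𝒳 𝒴 𝒜 : Type*) [MeasurableSpace 𝒴] (H : ℕ) : Type _ :=
  (k : ℕ) → (Fin k → Traj 𝒳 𝒴 𝒜 H) → Policy 𝒴 𝒜 H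

/-- The data available before round `k`. -/
def past {α : Type*} {K : ℕ} (D : Fin K → α) (k : Fin K) : Fin k → α :=
  fun i => D (Fin.castLE k.isLt.le i)

/-- The law of the data of `K` rounds when the learner `L` interacts with the model `M`: given the
data of the previous rounds, round `k` is distributed as `trajLaw M (L k (past D k))`. -/
def dataLaw (M : POMDP 𝒳 𝒜 ν) (L : Learner 𝒳 𝒴 𝒜 H) (K : ℕ) :
    Measure (Fin K → Traj 𝒳 𝒴 𝒜 H) :=
  (Measure.pi fun _ : Fin K => (trajRef ν : Measure (Traj 𝒳 𝒴 𝒜 H))).withDensity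
    fun D => ∏ k : Fin K, trajDensity M (L k (past D k)) (D k)

/-- The regret over `K` rounds with respect to the policy `πstar`. -/
def regret (M : POMDP 𝒳 𝒜 ν) (L : Learner 𝒳 𝒴 𝒜 H) (πstar : Policy 𝒴 𝒜 H) {K : ℕ}
    (D : Fin K → Traj 𝒳 𝒴 𝒜 H) : ℝ :=
  ∑ k : Fin K, (value M πstar - value M (L k (past D k)))

end Model

section Algorithm

set_option linter.unusedSectionVars false

variable {𝒳 𝒴 𝒜 : Type*} [Fintype 𝒳] [DecidableEq 𝒳] [Fintype 𝒜] [DecidableEq 𝒜]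
  [MeasurableSpace 𝒴] {ν : Measure 𝒴} {H k : ℕ}

/-- Number of visits to the latent state `x` in the data. -/
def countX (D : Fin k → Traj 𝒳 𝒴 𝒜 H) (x : 𝒳) : ℕ :=
  ∑ l : Fin k, ∑ h : Fin H, if (D l).1 h.castSucc = x then 1 else 0

/-- Number of visits to the latent state `x` with action `a` in the data. -/
def countXA (D : Fin k → Traj 𝒳 𝒴 𝒜 H) (x : 𝒳) (a : 𝒜) : ℕ :=
  ∑ l : Fin k, ∑ h : Fin H, if (D l).1 h.castSucc = x ∧ (D l).2.2 h = a then 1 else 0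

/-- Number of observed transitions from `(x, a)` to `x'` in the data. -/
def countXAX (D : Fin k → Traj 𝒳 𝒴 𝒜 H) (x : 𝒳) (a : 𝒜) (x' : 𝒳) : ℕ :=
  ∑ l : Fin k, ∑ h : Fin H,
    if (D l).1 h.castSucc = x ∧ (D l).2.2 h = a ∧ (D l).1 h.succ = x' then 1 else 0

theorem sum_countXAX (D : Fin k → Traj 𝒳 𝒴 𝒜 H) (x : 𝒳) (a : 𝒜) :
    ∑ x', countXAX D x a x' = countXA D x a := by
  unfold countXAX countXA
  rw [Finset.sum_comm]
  refine Finset.sum_congr rfl fun l _ => ?_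
  rw [Finset.sum_comm]
  refine Finset.sum_congr rfl fun h _ => ?_
  by_cases h1 : (D l).1 h.castSucc = x <;> by_cases h2 : (D l).2.2 h = a <;> simp [h1, h2]

/-- The empirical transition function; pairs `(x, a)` without data keep the initial guess. -/
def transEst (T₁ : 𝒳 → 𝒜 → PMF 𝒳) (D : Fin k → Traj 𝒳 𝒴 𝒜 H) (x : 𝒳) (a : 𝒜) : PMF 𝒳 :=
  if hn : countXA D x a = 0 then T₁ x a
  else PMF.ofFintype (fun x' => (countXAX D x a x' : ℝ≥0∞) / (countXA D x a : ℝ≥0∞)) (by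
    simp only [div_eq_mul_inv]
    rw [← Finset.sum_mul, ← Nat.cast_sum, sum_countXAX]
    exact ENNReal.mul_inv_cancel (by exact_mod_cast hn) (ENNReal.natCast_ne_top _))

/-- The log-likelihood `∑ log O(y_h | x_h)` of the data, with `log 0 = -∞`. -/
def logLik (O : Emission 𝒳 ν) (D : Fin k → Traj 𝒳 𝒴 𝒜 H) : EReal :=
  ∑ l : Fin k, ∑ h : Fin H,
    ENNReal.log (O.density ((D l).1 h.castSucc) ((D l).2.1 h) : ℝ≥0∞)

/-- `O` is a maximum likelihood estimate in the class `Θ` for the data `D`. -/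
def IsMLE (Θ : Finset (Emission 𝒳 ν)) (D : Fin k → Traj 𝒳 𝒴 𝒜 H) (O : Emission 𝒳 ν) : Prop :=
  O ∈ Θ ∧ ∀ O' ∈ Θ, logLik O' D ≤ logLik O D

/-- The truncated bonus `min {2, √(β / n)}`, equal to `2` for `n = 0`. -/
def bonus (β : ℝ) (n : ℕ) : ℝ :=
  if n = 0 then 2 else min 2 (Real.sqrt (β / n))

/-- The transition bonus `ε_k(x, a)`. -/
def bonusXA (K : ℕ) (δ : ℝ) (D : Fin k → Traj 𝒳 𝒴 𝒜 H) (x : 𝒳) (a : 𝒜) : ℝ :=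
  bonus (8 * Fintype.card 𝒳 *
    Real.log ((Fintype.card 𝒳 : ℝ) ^ 2 * Fintype.card 𝒜 * K * H / δ)) (countXA D x a)

/-- The emission bonus `ε_k(x)`; `N` is the cardinality of the emission class. -/
def bonusX (N K : ℕ) (δ : ℝ) (D : Fin k → Traj 𝒳 𝒴 𝒜 H) (x : 𝒳) : ℝ :=
  bonus (8 * Real.log ((N : ℝ) * Fintype.card 𝒳 * K / δ)) (countX D x)

/-- The optimistic reward `r(x, a) + 3 H ε_k(x, a) + H ε_k(x)`. -/
def optReward (r : 𝒳 → 𝒜 → ℝ) (N K : ℕ) (δ : ℝ) (D : Fin k → Traj 𝒳 𝒴 𝒜 H)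
    (x : 𝒳) (a : 𝒜) : ℝ :=
  r x a + 3 * H * bonusXA K δ D x a + H * bonusX N K δ D x

/-- HOP-B with an emission class of `N` elements: in each round plan optimally for the estimated
transitions, the estimated emissions and the optimistic reward. In the first round the models are
the initial guesses `T₁`, `O₁`; afterwards emissions are given by the estimator `mle`. -/
def hopB (r : 𝒳 → 𝒜 → ℝ) (N K : ℕ) (δ : ℝ) (T₁ : 𝒳 → 𝒜 → PMF 𝒳) (O₁ : Emission 𝒳 ν)
    (POP : (𝒳 → 𝒜 → PMF 𝒳) → Emission 𝒳 ν → (𝒳 → 𝒜 → ℝ) → Policy 𝒴 𝒜 H)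
    (mle : (k : ℕ) → (Fin k → Traj 𝒳 𝒴 𝒜 H) → Emission 𝒳 ν) : Learner 𝒳 𝒴 𝒜 H :=
  fun k D => POP (transEst T₁ D) (if k = 0 then O₁ else mle k D) (optReward r N K δ D)

end Algorithm

end HOMDP

end

/-! The proof is optimism plus a simulation lemma. By `value_le_value_add_discrepancy`, the value
under one model exceeds that under another by at most the maximal return times the expected sum of
one-step emission and transition discrepancies along the path, and the expectation may be taken
under whichever model is chosen as the base. Suppose all discrepancies lie below the bonuses. With
the estimated model as base, the bonus inside `optReward` pays for the estimation error, so the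
planned policy has optimistic value at least that of `πstar`. With the true model as base, the
optimistic value of the deployed policy is compared with its true value. Optimistic rewards are of
order `H` and returns of order `H ^ 2`, so the regret of a round is at most `12 * H ^ 2` times the
bonus that the deployed policy is expected to collect in the true model (`value_sub_le_totalBonus`).

Expected bonuses are at most twice the collected ones plus a term of order `H * log (1 / δ)`
(`dataLaw_sum_value_gt_le`). The collected ones obey the pigeonhole bound `sum_bonus_le`, of order
`√(K * H)` up to the number of cells and logarithms, which gives `H ^ (5/2)` in total. Terms that do
not grow with `K` are absorbed using the trivial bound `K * H` on the regret
(`combine_regret_bounds`).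

The three failure events, each of probability at most `δ`, follow from one change of measure,
`dataLaw_le_of_density_le`, which plays the role of a supermartingale inequality: a set on which the
data density is at most `c` times a product of conditional sub-densities has probability at most
`c`. The sub-densities are the true ones with exponentially tilted transitions
(`dataLaw_transEst_bad_le`), with emissions replaced by a multiple of the geometric mean of two
emission densities (`dataLaw_mle_bad_le`), or weighted by the exponential of half the expected
return minus the return (`dataLaw_sum_value_gt_le`). -/

noncomputable section

namespace HOMDP

/-! ### Integration over trajectories, one step at a time. -/

section Weights

set_option linter.unusedSectionVars false

variable {𝒳 𝒴 𝒜 : Type*} [Fintype 𝒳] [MeasurableSpace 𝒳] [DiscreteMeasurableSpace 𝒳]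
  [Fintype 𝒜] [MeasurableSpace 𝒜] [DiscreteMeasurableSpace 𝒜] [MeasurableSpace 𝒴]
  {ν : Measure 𝒴} {H : ℕ}

/-- Append one observation, action and latent state to a trajectory. -/
def Traj.snoc (τ : Traj 𝒳 𝒴 𝒜 H) (y : 𝒴) (a : 𝒜) (x : 𝒳) : Traj 𝒳 𝒴 𝒜 (H + 1) :=
  (Fin.snoc τ.1 x, Fin.snoc τ.2.1 y, Fin.snoc τ.2.2 a)

theorem lintegral_trajRef [SigmaFinite ν] {F : Traj 𝒳 𝒴 𝒜 H → ℝ≥0∞} (hF : Measurable F) :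
    ∫⁻ τ, F τ ∂(trajRef ν) =
      ∑ xs, ∑ as, ∫⁻ ys, F (xs, ys, as) ∂(Measure.pi fun _ : Fin H => ν) := by
  unfold trajRef
  rw [lintegral_prod _ hF.aemeasurable, lintegral_count, tsum_fintype]
  refine Finset.sum_congr rfl fun xs _ => ?_
  rw [lintegral_prod_symm _ (by fun_prop), lintegral_count, tsum_fintype]

theorem lintegral_pi_snoc [SigmaFinite ν] (n : ℕ) {F : (Fin (n + 1) → 𝒴) → ℝ≥0∞}
    (hF : Measurable F) :
    ∫⁻ ys, F ys ∂(Measure.pi fun _ : Fin (n + 1) => ν) =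
      ∫⁻ ys, ∫⁻ y, F (Fin.snoc ys y) ∂ν ∂(Measure.pi fun _ : Fin n => ν) := by
  have h := (measurePreserving_piFinSuccAbove (fun _ : Fin (n + 1) => ν) (Fin.last n)).symm
  rw [← h.lintegral_comp hF, lintegral_prod_symm _ (by fun_prop)]
  simp [MeasurableEquiv.piFinSuccAbove, Fin.insertNthEquiv_last, Fin.snocEquiv]

theorem sum_pi_snoc {α β : Type*} [Fintype α] [AddCommMonoid β] (n : ℕ)
    (F : (Fin (n + 1) → α) → β) :
    ∑ v, F v = ∑ v : Fin n → α, ∑ a, F (Fin.snoc v a) := by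
  rw [← (Fin.snocEquiv fun _ : Fin (n + 1) => α).sum_comp, Fintype.sum_prod_type,
    Finset.sum_comm]
  rfl

theorem measurable_snoc {α : Type*} [MeasurableSpace α] (n : ℕ) :
    Measurable fun p : (Fin n → α) × α => (Fin.snoc p.1 p.2 : Fin (n + 1) → α) := by
  refine measurable_pi_iff.2 fun i => ?_
  refine Fin.lastCases ?_ (fun j => ?_) i
  · simpa using measurable_snd
  · simp only [Fin.snoc_castSucc]; fun_prop

/-- Fubini with the last step innermost, the basis of all inductions on the horizon. Peeling from
the end leaves a prefix governed by the same initial law and by `π.init`; peeling from the start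
would change both. -/
theorem lintegral_trajRef_succ [SigmaFinite ν] {F : Traj 𝒳 𝒴 𝒜 (H + 1) → ℝ≥0∞}
    (hF : Measurable F) :
    ∫⁻ τ, F τ ∂(trajRef ν) =
      ∫⁻ τ, ∑ a, ∑ x, ∫⁻ y, F (τ.snoc y a x) ∂ν ∂(trajRef ν) := by
  have hs : Measurable fun p : Traj 𝒳 𝒴 𝒜 H × 𝒴 × 𝒜 × 𝒳 => p.1.snoc p.2.1 p.2.2.1 p.2.2.2 := by
    unfold Traj.snoc
    refine Measurable.prodMk ?_ (Measurable.prodMk ?_ ?_)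
    · exact (measurable_snoc (α := 𝒳) (H + 1)).comp
        (f := fun p : Traj 𝒳 𝒴 𝒜 H × 𝒴 × 𝒜 × 𝒳 => (p.1.1, p.2.2.2)) (by fun_prop)
    · exact (measurable_snoc (α := 𝒴) H).comp
        (f := fun p : Traj 𝒳 𝒴 𝒜 H × 𝒴 × 𝒜 × 𝒳 => (p.1.2.1, p.2.1)) (by fun_prop)
    · exact (measurable_snoc (α := 𝒜) H).comp
        (f := fun p : Traj 𝒳 𝒴 𝒜 H × 𝒴 × 𝒜 × 𝒳 => (p.1.2.2, p.2.2.1)) (by fun_prop)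
  have hFs : Measurable fun p : Traj 𝒳 𝒴 𝒜 H × 𝒴 × 𝒜 × 𝒳 =>
      F (p.1.snoc p.2.1 p.2.2.1 p.2.2.2) := hF.comp hs
  have hin : ∀ a x, Measurable fun τ : Traj 𝒳 𝒴 𝒜 H => ∫⁻ y, F (τ.snoc y a x) ∂ν := fun a x =>
    Measurable.lintegral_prod_right' (f := fun p : Traj 𝒳 𝒴 𝒜 H × 𝒴 => F (p.1.snoc p.2 a x))
      (hFs.comp (f := fun p : Traj 𝒳 𝒴 𝒜 H × 𝒴 => (p.1, p.2, a, x)) (by fun_prop))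
  rw [lintegral_trajRef hF, lintegral_trajRef
    (Finset.measurable_sum _ fun a _ => Finset.measurable_sum _ fun x _ => hin a x), sum_pi_snoc]
  refine Finset.sum_congr rfl fun xs _ => ?_
  simp_rw [sum_pi_snoc (α := 𝒜)]
  rw [Finset.sum_comm]
  refine Finset.sum_congr rfl fun as _ => ?_
  have hm : ∀ a x, Measurable fun ys : Fin H → 𝒴 => ∫⁻ y, F ((xs, ys, as) |> (Traj.snoc · y a x)) ∂ν :=
    fun a x => (hin a x).comp (by fun_prop)
  rw [lintegral_finsetSum _ fun a _ => Finset.measurable_sum _ fun x _ => hm a x, Finset.sum_comm]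
  refine Finset.sum_congr rfl fun a _ => ?_
  rw [lintegral_finsetSum _ fun x _ => hm a x]
  refine Finset.sum_congr rfl fun x _ => ?_
  rw [lintegral_pi_snoc _ (by fun_prop)]
  rfl

/-- The policy followed during the first `H` steps. -/
def Policy.init (π : Policy 𝒴 𝒜 (H + 1)) : Policy 𝒴 𝒜 H where
  act h := π.act h.castSucc
  measurable_act h := π.measurable_act h.castSucc

/-- The unnormalised density of a trajectory for observation weights `E` and transition
weights `T`. -/
def trajWeight (ρ : PMF 𝒳) (E : 𝒳 → 𝒴 → ℝ≥0∞) (T : 𝒳 → 𝒜 → 𝒳 → ℝ≥0∞) (π : Policy 𝒴 𝒜 H)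
    (τ : Traj 𝒳 𝒴 𝒜 H) : ℝ≥0∞ :=
  ρ (τ.1 0) *
    ∏ h : Fin H,
      (E (τ.1 h.castSucc) (τ.2.1 h) *
        π.act h (fun i => τ.2.1 (Fin.castLE h.isLt i))
          (fun i => τ.2.2 (Fin.castLE h.isLt.le i)) (τ.2.2 h) *
        T (τ.1 h.castSucc) (τ.2.2 h) (τ.1 h.succ))

theorem trajDensity_eq_trajWeight (M : POMDP 𝒳 𝒜 ν) (π : Policy 𝒴 𝒜 H) :
    trajDensity M π = trajWeight M.init (fun x y => M.emit.density x y)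
      (fun x a x' => M.trans x a x') π := rfl

/-- The distribution of the last action given the history before it. -/
def Policy.lastAct (π : Policy 𝒴 𝒜 (H + 1)) (τ : Traj 𝒳 𝒴 𝒜 H) (y : 𝒴) : PMF 𝒜 :=
  π.act (Fin.last H) (Fin.snoc τ.2.1 y) τ.2.2

theorem trajWeight_snoc (ρ : PMF 𝒳) (E : 𝒳 → 𝒴 → ℝ≥0∞) (T : 𝒳 → 𝒜 → 𝒳 → ℝ≥0∞)
    (π : Policy 𝒴 𝒜 (H + 1)) (τ : Traj 𝒳 𝒴 𝒜 H) (y : 𝒴) (a : 𝒜) (x : 𝒳) :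
    trajWeight ρ E T π (τ.snoc y a x) = trajWeight ρ E T π.init τ *
      (E (τ.1 (Fin.last H)) y * π.lastAct τ y a * T (τ.1 (Fin.last H)) a x) := by
  unfold trajWeight
  rw [Fin.prod_univ_castSucc, ← mul_assoc]
  have hx0 : (τ.snoc y a x).1 0 = τ.1 0 := by
    show (Fin.snoc τ.1 x : Fin (H + 2) → 𝒳) (Fin.castSucc 0) = τ.1 0
    exact Fin.snoc_castSucc (α := fun _ => 𝒳) _ _ _
  have hx : ∀ i : Fin (H + 1), (τ.snoc y a x).1 i.castSucc = τ.1 i := fun i =>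
    Fin.snoc_castSucc (α := fun _ => 𝒳) _ _ _
  have hy : ∀ i : Fin H, (τ.snoc y a x).2.1 i.castSucc = τ.2.1 i := fun i =>
    Fin.snoc_castSucc (α := fun _ => 𝒴) _ _ _
  have ha : ∀ i : Fin H, (τ.snoc y a x).2.2 i.castSucc = τ.2.2 i := fun i =>
    Fin.snoc_castSucc (α := fun _ => 𝒜) _ _ _
  have hyl : (τ.snoc y a x).2.1 (Fin.last H) = y := Fin.snoc_last (α := fun _ => 𝒴) _ _
  have hal : (τ.snoc y a x).2.2 (Fin.last H) = a := Fin.snoc_last (α := fun _ => 𝒜) _ _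
  have hxl : (τ.snoc y a x).1 (Fin.last H).succ = x := Fin.snoc_last (α := fun _ => 𝒳) _ _
  have hpl : π.act (Fin.last H)
      (fun i => (τ.snoc y a x).2.1 (Fin.castLE (Fin.last H).isLt i))
      (fun i => (τ.snoc y a x).2.2 (Fin.castLE (Fin.last H).isLt.le i)) = π.lastAct τ y := by
    unfold Policy.lastAct
    congr 1
    funext i
    exact ha i
  have hpi : ∀ h : Fin H, π.act h.castSucc
      (fun i => (τ.snoc y a x).2.1 (Fin.castLE h.castSucc.isLt i))
      (fun i => (τ.snoc y a x).2.2 (Fin.castLE h.castSucc.isLt.le i)) =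
      π.init.act h (fun i => τ.2.1 (Fin.castLE h.isLt i))
          (fun i => τ.2.2 (Fin.castLE h.isLt.le i)) := by
    intro h
    show π.act h.castSucc _ _ = π.act h.castSucc _ _
    congr 1
    · funext i; exact hy (Fin.castLE h.isLt i)
    · funext i; exact ha (Fin.castLE h.isLt.le i)
  simp only [hx0, hx, hy, ha, hyl, hal, hxl, hpl, hpi, ← Fin.castSucc_succ]

theorem measurable_trajWeight (ρ : PMF 𝒳) {E : 𝒳 → 𝒴 → ℝ≥0∞} (hE : ∀ x, Measurable (E x))
    (T : 𝒳 → 𝒜 → 𝒳 → ℝ≥0∞) (π : Policy 𝒴 𝒜 H) : Measurable (trajWeight ρ E T π) := by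
  have : Measurable fun q : ((Fin (H + 1) → 𝒳) × (Fin H → 𝒜)) × (Fin H → 𝒴) =>
      trajWeight ρ E T π (q.1.1, q.2, q.1.2) := by
    refine measurable_from_prod_countable_right fun q => ?_
    simp only [trajWeight]
    refine Measurable.mul (measurable_const (a := ρ (q.1 0))) ?_
    refine Finset.measurable_prod _ fun h _ => ?_
    refine (Measurable.mul ?_ ?_).mul measurable_const
    · exact (hE _).comp (measurable_pi_apply h)
    · exact (π.measurable_act h _ _).comp (by fun_prop)
  exact this.comp (f := fun τ : Traj 𝒳 𝒴 𝒜 H => ((τ.1, τ.2.2), τ.2.1)) (by fun_prop)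

end Weights

/-! ### Total mass of path weights and comparison of two path laws. -/

section Mass

set_option linter.unusedSectionVars false

variable {𝒳 𝒴 𝒜 : Type*} [Fintype 𝒳] [MeasurableSpace 𝒳] [DiscreteMeasurableSpace 𝒳]
  [Fintype 𝒜] [MeasurableSpace 𝒜] [DiscreteMeasurableSpace 𝒜] [MeasurableSpace 𝒴]
  {ν : Measure 𝒴} {H : ℕ}

theorem Policy.measurable_lastAct (π : Policy 𝒴 𝒜 (H + 1)) (τ : Traj 𝒳 𝒴 𝒜 H) (a : 𝒜) :
    Measurable fun y => π.lastAct τ y a :=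
  (π.measurable_act (Fin.last H) τ.2.2 a).comp
    ((measurable_snoc H).comp (f := fun y => (τ.2.1, y)) (by fun_prop))

theorem sum_pmf (p : PMF 𝒜) : ∑ a, p a = 1 := by
  rw [← tsum_fintype (L := .unconditional _)]; exact p.tsum_coe

theorem sum_lintegral_step (π : Policy 𝒴 𝒜 (H + 1)) (τ : Traj 𝒳 𝒴 𝒜 H) {E : 𝒴 → ℝ≥0∞}
    (hE : Measurable E) (T : 𝒜 → 𝒳 → ℝ≥0∞) :
    ∑ a, ∑ x, ∫⁻ y, E y * π.lastAct τ y a * T a x ∂ν =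
      ∑ a, (∫⁻ y, E y * π.lastAct τ y a ∂ν) * ∑ x, T a x := by
  refine Finset.sum_congr rfl fun a _ => ?_
  rw [Finset.mul_sum]
  refine Finset.sum_congr rfl fun x _ => ?_
  exact lintegral_mul_const _ (hE.fun_mul (π.measurable_lastAct τ a))

theorem sum_lintegral_lastAct (π : Policy 𝒴 𝒜 (H + 1)) (τ : Traj 𝒳 𝒴 𝒜 H) {E : 𝒴 → ℝ≥0∞}
    (hE : Measurable E) :
    ∑ a, ∫⁻ y, E y * π.lastAct τ y a ∂ν = ∫⁻ y, E y ∂ν := by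
  rw [← lintegral_finsetSum _ fun a _ => hE.fun_mul (π.measurable_lastAct τ a)]
  simp_rw [← Finset.mul_sum, sum_pmf, mul_one]

theorem lintegral_trajRef_zero [SigmaFinite ν] {F : Traj 𝒳 𝒴 𝒜 0 → ℝ≥0∞} (hF : Measurable F) :
    ∫⁻ τ, F τ ∂(trajRef ν) = ∑ x, F (fun _ => x, Fin.elim0, Fin.elim0) := by
  rw [lintegral_trajRef hF, ← (Equiv.funUnique (Fin 1) 𝒳).symm.sum_comp]
  refine Finset.sum_congr rfl fun x _ => ?_
  rw [Fintype.sum_unique, Measure.pi_of_empty, lintegral_dirac' _ (by fun_prop)]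
  congr 1

theorem trajWeight_zero (ρ : PMF 𝒳) (E : 𝒳 → 𝒴 → ℝ≥0∞) (T : 𝒳 → 𝒜 → 𝒳 → ℝ≥0∞)
    (π : Policy 𝒴 𝒜 0) (τ : Traj 𝒳 𝒴 𝒜 0) : trajWeight ρ E T π τ = ρ (τ.1 0) := by
  simp [trajWeight]

theorem lintegral_trajWeight_succ [SigmaFinite ν] (ρ : PMF 𝒳) {E : 𝒳 → 𝒴 → ℝ≥0∞}
    (hE : ∀ x, Measurable (E x)) (T : 𝒳 → 𝒜 → 𝒳 → ℝ≥0∞) (π : Policy 𝒴 𝒜 (H + 1)) :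
    ∫⁻ τ, trajWeight ρ E T π τ ∂(trajRef ν) =
      ∫⁻ τ, trajWeight ρ E T π.init τ *
        ∑ a, (∫⁻ y, E (τ.1 (Fin.last H)) y * π.lastAct τ y a ∂ν) *
          ∑ x, T (τ.1 (Fin.last H)) a x ∂(trajRef ν) := by
  rw [lintegral_trajRef_succ (measurable_trajWeight ρ hE T π)]
  refine lintegral_congr fun τ => ?_
  rw [← sum_lintegral_step π τ (hE _), Finset.mul_sum]
  refine Finset.sum_congr rfl fun a _ => ?_
  rw [Finset.mul_sum]
  refine Finset.sum_congr rfl fun x _ => ?_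
  simp_rw [trajWeight_snoc]
  exact lintegral_const_mul _ (((hE _).mul (π.measurable_lastAct τ a)).mul_const _)

/-- The inequality version serves the tilted weights, which are only sub-probability kernels. -/
theorem lintegral_trajWeight_le_one [SigmaFinite ν] (ρ : PMF 𝒳) {E : 𝒳 → 𝒴 → ℝ≥0∞}
    (hE : ∀ x, Measurable (E x)) (hE1 : ∀ x, ∫⁻ y, E x y ∂ν ≤ 1) {T : 𝒳 → 𝒜 → 𝒳 → ℝ≥0∞}
    (hT : ∀ x a, ∑ x', T x a x' ≤ 1) (π : Policy 𝒴 𝒜 H) :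
    ∫⁻ τ, trajWeight ρ E T π τ ∂(trajRef ν) ≤ 1 := by
  induction H with
  | zero =>
    rw [lintegral_trajRef_zero (measurable_trajWeight ρ hE T π)]
    simp_rw [trajWeight_zero]
    exact (sum_pmf ρ).le
  | succ H ih =>
    rw [lintegral_trajWeight_succ ρ hE]
    refine (lintegral_mono fun τ => ?_).trans (ih π.init)
    refine mul_le_of_le_one_right' ?_
    refine (Finset.sum_le_sum fun a _ => mul_le_of_le_one_right' (hT _ a)).trans ?_
    rw [sum_lintegral_lastAct π τ (hE _)]
    exact hE1 _

theorem lintegral_trajWeight_eq_one [SigmaFinite ν] (ρ : PMF 𝒳) {E : 𝒳 → 𝒴 → ℝ≥0∞}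
    (hE : ∀ x, Measurable (E x)) (hE1 : ∀ x, ∫⁻ y, E x y ∂ν = 1) {T : 𝒳 → 𝒜 → 𝒳 → ℝ≥0∞}
    (hT : ∀ x a, ∑ x', T x a x' = 1) (π : Policy 𝒴 𝒜 H) :
    ∫⁻ τ, trajWeight ρ E T π τ ∂(trajRef ν) = 1 := by
  induction H with
  | zero =>
    rw [lintegral_trajRef_zero (measurable_trajWeight ρ hE T π)]
    simp_rw [trajWeight_zero]
    exact sum_pmf ρ
  | succ H ih =>
    rw [lintegral_trajWeight_succ ρ hE, ← ih π.init]
    refine lintegral_congr fun τ => ?_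
    simp_rw [hT, mul_one]
    rw [sum_lintegral_lastAct π τ (hE _), hE1, mul_one]

/-- The sum of the one-step discrepancies along a trajectory. -/
def pathCost (dO : 𝒳 → ℝ≥0∞) (dT : 𝒳 → 𝒜 → ℝ≥0∞) (τ : Traj 𝒳 𝒴 𝒜 H) : ℝ≥0∞ :=
  ∑ h : Fin H, (dO (τ.1 h.castSucc) + dT (τ.1 h.castSucc) (τ.2.2 h))

theorem measurable_of_latent_action {β : Type*} [MeasurableSpace β]
    (f : (Fin (H + 1) → 𝒳) → (Fin H → 𝒜) → β) :
    Measurable fun τ : Traj 𝒳 𝒴 𝒜 H => f τ.1 τ.2.2 :=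
  (measurable_of_countable fun q : (Fin (H + 1) → 𝒳) × (Fin H → 𝒜) => f q.1 q.2).comp
    (f := fun τ : Traj 𝒳 𝒴 𝒜 H => (τ.1, τ.2.2)) (by fun_prop)

theorem measurable_pathCost (dO : 𝒳 → ℝ≥0∞) (dT : 𝒳 → 𝒜 → ℝ≥0∞) :
    Measurable (pathCost dO dT : Traj 𝒳 𝒴 𝒜 H → ℝ≥0∞) :=
  measurable_of_latent_action fun xs as =>
    ∑ h : Fin H, (dO (xs h.castSucc) + dT (xs h.castSucc) (as h))

theorem pathCost_snoc (dO : 𝒳 → ℝ≥0∞) (dT : 𝒳 → 𝒜 → ℝ≥0∞) (τ : Traj 𝒳 𝒴 𝒜 H) (y : 𝒴) (a : 𝒜)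
    (x : 𝒳) : pathCost dO dT (τ.snoc y a x) =
      pathCost dO dT τ + (dO (τ.1 (Fin.last H)) + dT (τ.1 (Fin.last H)) a) := by
  unfold pathCost
  rw [Fin.sum_univ_castSucc]
  have hx : ∀ i : Fin (H + 1), (τ.snoc y a x).1 i.castSucc = τ.1 i := fun i =>
    Fin.snoc_castSucc (α := fun _ => 𝒳) _ _ _
  have ha : ∀ i : Fin H, (τ.snoc y a x).2.2 i.castSucc = τ.2.2 i := fun i =>
    Fin.snoc_castSucc (α := fun _ => 𝒜) _ _ _
  have hal : (τ.snoc y a x).2.2 (Fin.last H) = a := Fin.snoc_last (α := fun _ => 𝒜) _ _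
  simp only [hx, ha, hal]

/-- The last step has conditional mass one, so it leaves the earlier cost unchanged, and its own
cost does not involve the final state, which sums out. -/
theorem lintegral_trajWeight_mul_pathCost_succ [SigmaFinite ν] (ρ : PMF 𝒳) {E : 𝒳 → 𝒴 → ℝ≥0∞}
    (hE : ∀ x, Measurable (E x)) (hE1 : ∀ x, ∫⁻ y, E x y ∂ν = 1) {T : 𝒳 → 𝒜 → 𝒳 → ℝ≥0∞}
    (hT : ∀ x a, ∑ x', T x a x' = 1) (dO : 𝒳 → ℝ≥0∞) (dT : 𝒳 → 𝒜 → ℝ≥0∞)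
    (π : Policy 𝒴 𝒜 (H + 1)) :
    ∫⁻ τ, trajWeight ρ E T π τ * pathCost dO dT τ ∂(trajRef ν) =
      ∫⁻ τ, trajWeight ρ E T π.init τ * (pathCost dO dT τ + (dO (τ.1 (Fin.last H)) +
        ∑ a, (∫⁻ y, E (τ.1 (Fin.last H)) y * π.lastAct τ y a ∂ν) *
          dT (τ.1 (Fin.last H)) a)) ∂(trajRef ν) := by
  rw [lintegral_trajRef_succ ((measurable_trajWeight ρ hE T π).fun_mul (measurable_pathCost dO dT))]
  refine lintegral_congr fun τ => ?_
  have key : ∀ a x, ∫⁻ y, trajWeight ρ E T π (τ.snoc y a x) * pathCost dO dT (τ.snoc y a x) ∂ν =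
      trajWeight ρ E T π.init τ * ((∫⁻ y, E (τ.1 (Fin.last H)) y * π.lastAct τ y a ∂ν) *
        T (τ.1 (Fin.last H)) a x *
        (pathCost dO dT τ + (dO (τ.1 (Fin.last H)) + dT (τ.1 (Fin.last H)) a))) := by
    intro a x
    have hm := (hE (τ.1 (Fin.last H))).fun_mul (π.measurable_lastAct τ a)
    rw [← lintegral_mul_const _ hm, ← lintegral_mul_const _ (hm.mul_const _),
      ← lintegral_const_mul _ ((hm.mul_const _).mul_const _)]
    refine lintegral_congr fun y => ?_
    rw [trajWeight_snoc, pathCost_snoc, mul_assoc]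
  simp_rw [key, ← Finset.mul_sum, ← Finset.sum_mul, ← Finset.mul_sum, hT, mul_one, ← add_assoc,
    mul_add, Finset.sum_add_distrib, ← Finset.sum_mul, sum_lintegral_lastAct π τ (hE _), hE1,
    one_mul, mul_add]

theorem ENNReal_mul_tsub_mul_le (a b a' b' : ℝ≥0∞) :
    a' * b' - a * b ≤ (a' - a) * b' + a * (b' - b) := by
  rw [tsub_le_iff_right, add_assoc, ← mul_add]
  calc a' * b' ≤ ((a' - a) + a) * b' := by gcongr; exact le_tsub_add
    _ = (a' - a) * b' + a * b' := add_mul _ _ _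
    _ ≤ _ := by gcongr; exact le_tsub_add

/-- Comparing the laws of a trajectory under two models: the excess mass is at most the expected
sum of the one-step discrepancies along the path. -/
theorem lintegral_trajWeight_tsub_le [SigmaFinite ν] (ρ : PMF 𝒳) {E E' : 𝒳 → 𝒴 → ℝ≥0∞}
    (hE : ∀ x, Measurable (E x)) (hE1 : ∀ x, ∫⁻ y, E x y ∂ν = 1)
    (hE' : ∀ x, Measurable (E' x)) (hE1' : ∀ x, ∫⁻ y, E' x y ∂ν = 1)
    {T T' : 𝒳 → 𝒜 → 𝒳 → ℝ≥0∞}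
    (hT : ∀ x a, ∑ x', T x a x' = 1) (hT' : ∀ x a, ∑ x', T' x a x' = 1)
    {dO : 𝒳 → ℝ≥0∞} {dT : 𝒳 → 𝒜 → ℝ≥0∞}
    (hdO : ∀ x, ∫⁻ y, (E' x y - E x y) ∂ν ≤ dO x)
    (hdT : ∀ x a, ∑ x', (T' x a x' - T x a x') ≤ dT x a) (π : Policy 𝒴 𝒜 H) :
    ∫⁻ τ, (trajWeight ρ E' T' π τ - trajWeight ρ E T π τ) ∂(trajRef ν) ≤
      ∫⁻ τ, trajWeight ρ E T π τ * pathCost dO dT τ ∂(trajRef ν) := by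
  induction H with
  | zero =>
    simp_rw [trajWeight_zero, tsub_self]
    simp
  | succ H ih =>
    have hw := measurable_trajWeight ρ hE T π
    have hw' := measurable_trajWeight ρ hE' T' π
    rw [lintegral_trajWeight_mul_pathCost_succ ρ hE hE1 hT, lintegral_trajRef_succ (hw'.fun_sub hw)]
    simp_rw [mul_add (trajWeight ρ E T π.init _) (pathCost dO dT _)]
    rw [lintegral_add_left
      ((measurable_trajWeight ρ hE T π.init).fun_mul (measurable_pathCost dO dT))]
    refine le_trans ?_ (add_le_add_left (ih π.init) _)
    rw [← lintegral_add_left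
      ((measurable_trajWeight ρ hE' T' π.init).fun_sub (measurable_trajWeight ρ hE T π.init))]
    refine lintegral_mono fun τ => ?_
    set x₀ := τ.1 (Fin.last H)
    set w := trajWeight ρ E T π.init τ
    set w' := trajWeight ρ E' T' π.init τ
    have hP := fun a => π.measurable_lastAct τ a
    -- Hybrid argument: replace the factors one at a time. The first term carries the excess of the
    -- prefix, handled by induction; the other two carry the emission and transition discrepancies
    -- of the last step. The policy factor is common to both models and contributes nothing.
    have hstep : ∀ a x, ∫⁻ y, (trajWeight ρ E' T' π (τ.snoc y a x) -
        trajWeight ρ E T π (τ.snoc y a x)) ∂ν ≤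
        (w' - w) * ((∫⁻ y, E' x₀ y * π.lastAct τ y a ∂ν) * T' x₀ a x) +
        w * ((∫⁻ y, (E' x₀ y - E x₀ y) * π.lastAct τ y a ∂ν) * T' x₀ a x +
          (∫⁻ y, E x₀ y * π.lastAct τ y a ∂ν) * (T' x₀ a x - T x₀ a x)) := by
      intro a x
      have h1 := (hE' x₀).fun_mul (hP a)
      have h2 := ((hE' x₀).fun_sub (hE x₀)).fun_mul (hP a)
      have h3 := (hE x₀).fun_mul (hP a)
      rw [← lintegral_mul_const _ h1, ← lintegral_mul_const _ h2, ← lintegral_mul_const _ h3,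
        ← lintegral_const_mul _ (h1.mul_const _), ← lintegral_add_left (h2.mul_const _),
        ← lintegral_const_mul _ ((h2.mul_const _).fun_add (h3.mul_const _)),
        ← lintegral_add_left ((h1.mul_const _).const_mul _)]
      refine lintegral_mono fun y => ?_
      simp only [trajWeight_snoc]
      refine (ENNReal_mul_tsub_mul_le _ _ _ _).trans ?_
      gcongr
      refine (ENNReal_mul_tsub_mul_le _ _ _ _).trans ?_
      gcongr
      simpa using ENNReal_mul_tsub_mul_le (E x₀ y) (π.lastAct τ y a) (E' x₀ y) (π.lastAct τ y a)
    refine (Finset.sum_le_sum fun a _ => Finset.sum_le_sum fun x _ => hstep a x).trans ?_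
    simp_rw [Finset.sum_add_distrib, ← Finset.mul_sum, Finset.sum_add_distrib, ← Finset.mul_sum,
      hT', mul_one]
    rw [sum_lintegral_lastAct π τ (hE' _), hE1', mul_one,
      sum_lintegral_lastAct π τ ((hE' _).fun_sub (hE _))]
    gcongr with a
    · exact hdO _
    · exact hdT _ _

end Mass

/-! ### Products of conditional densities over rounds. -/

section Sequential

theorem past_last {α : Type*} {K : ℕ} (D : Fin (K + 1) → α) :
    past D (Fin.last K) = Fin.init D := rfl

/-- The factor of a round depends only on the data up to that round, so the last round can be
integrated out with all earlier factors held fixed. -/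
theorem lintegral_prod_past_succ {α : Type*} [MeasurableSpace α] (μ : Measure α) [SigmaFinite μ]
    {f : (k : ℕ) → (Fin k → α) → α → ℝ≥0∞}
    (hf : ∀ k, Measurable fun q : (Fin k → α) × α => f k q.1 q.2) (K : ℕ) :
    ∫⁻ D, ∏ k : Fin (K + 1), f k (past D k) (D k) ∂(Measure.pi fun _ => μ) =
      ∫⁻ D, (∏ k : Fin K, f k (past D k) (D k)) * ∫⁻ τ, f K D τ ∂μ ∂(Measure.pi fun _ => μ) := by
  have hm : ∀ K, Measurable fun D : Fin K → α => ∏ k : Fin K, f k (past D k) (D k) := fun K =>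
    Finset.measurable_prod _ fun k _ =>
      (hf k).comp (f := fun D : Fin K → α => (past D k, D k))
        (Measurable.prodMk (by unfold past; fun_prop) (by fun_prop))
  rw [lintegral_pi_snoc _ (hm _)]
  refine lintegral_congr fun D => ?_
  have hK : Measurable (f K D) := (hf K).comp measurable_prodMk_left
  rw [← lintegral_const_mul _ hK]
  refine lintegral_congr fun τ => ?_
  rw [Fin.prod_univ_castSucc]
  congr 1
  · refine Finset.prod_congr rfl fun k _ => ?_
    have h1 : past (Fin.snoc D τ : Fin (K + 1) → α) k.castSucc = past D k := by
      funext i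
      exact Fin.snoc_castSucc (α := fun _ => α) τ D (Fin.castLE k.isLt.le i)
    rw [h1, Fin.snoc_castSucc (α := fun _ => α)]
    rfl
  · rw [past_last, Fin.init_snoc, Fin.snoc_last (α := fun _ => α)]
    rfl

theorem lintegral_prod_past_le_one {α : Type*} [MeasurableSpace α] (μ : Measure α) [SigmaFinite μ]
    {f : (k : ℕ) → (Fin k → α) → α → ℝ≥0∞}
    (hf : ∀ k, Measurable fun q : (Fin k → α) × α => f k q.1 q.2)
    (h1 : ∀ k p, ∫⁻ τ, f k p τ ∂μ ≤ 1) (K : ℕ) :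
    ∫⁻ D, ∏ k : Fin K, f k (past D k) (D k) ∂(Measure.pi fun _ => μ) ≤ 1 := by
  induction K with
  | zero => simp
  | succ K ih =>
    rw [lintegral_prod_past_succ μ hf]
    exact (lintegral_mono fun D => mul_le_of_le_one_right' (h1 K D)).trans ih

theorem lintegral_prod_past_eq_one {α : Type*} [MeasurableSpace α] (μ : Measure α) [SigmaFinite μ]
    {f : (k : ℕ) → (Fin k → α) → α → ℝ≥0∞}
    (hf : ∀ k, Measurable fun q : (Fin k → α) × α => f k q.1 q.2)
    (h1 : ∀ k p, ∫⁻ τ, f k p τ ∂μ = 1) (K : ℕ) :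
    ∫⁻ D, ∏ k : Fin K, f k (past D k) (D k) ∂(Measure.pi fun _ => μ) = 1 := by
  induction K with
  | zero => simp
  | succ K ih =>
    rw [lintegral_prod_past_succ μ hf, ← ih]
    simp_rw [h1, mul_one]

end Sequential

/-! ### The law of the data and changes of measure. -/

section Data

set_option linter.unusedSectionVars false

variable {𝒳 𝒴 𝒜 : Type*} [Fintype 𝒳] [MeasurableSpace 𝒳] [DiscreteMeasurableSpace 𝒳]
  [Fintype 𝒜] [MeasurableSpace 𝒜] [DiscreteMeasurableSpace 𝒜] [MeasurableSpace 𝒴]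
  {ν : Measure 𝒴} {H : ℕ}

instance [SigmaFinite ν] : SigmaFinite (trajRef ν : Measure (Traj 𝒳 𝒴 𝒜 H)) := by
  unfold trajRef; infer_instance

/-- The latent states and the actions of a list of trajectories. -/
def skeleton {k : ℕ} (D : Fin k → Traj 𝒳 𝒴 𝒜 H) : Fin k → (Fin (H + 1) → 𝒳) × (Fin H → 𝒜) :=
  fun l => ((D l).1, (D l).2.2)

theorem measurable_skeleton {k : ℕ} :
    Measurable (skeleton : (Fin k → Traj 𝒳 𝒴 𝒜 H) → _) := by
  unfold skeleton; fun_prop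

/-- A learner whose choices depend measurably on the data through finitely many values. -/
def Learner.IsSimple (L : Learner 𝒳 𝒴 𝒜 H) : Prop :=
  ∀ k, ∃ (n : ℕ) (idx : (Fin k → Traj 𝒳 𝒴 𝒜 H) → Fin n), Measurable idx ∧
    (L k).FactorsThrough idx

/-- Policies carry no σ-algebra. Finitely many values, selected measurably, split the data into
countably many measurable pieces on which the policy is constant, so joint measurability is checked
piecewise. -/
theorem Learner.IsSimple.measurable {L : Learner 𝒳 𝒴 𝒜 H} (hL : L.IsSimple) {k : ℕ}
    {Φ : (Fin k → (Fin (H + 1) → 𝒳) × (Fin H → 𝒜)) → Policy 𝒴 𝒜 H → Traj 𝒳 𝒴 𝒜 H → ℝ≥0∞}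
    (hΦ : ∀ s π, Measurable (Φ s π)) :
    Measurable fun q : (Fin k → Traj 𝒳 𝒴 𝒜 H) × Traj 𝒳 𝒴 𝒜 H =>
      Φ (skeleton q.1) (L k q.1) q.2 := by
  classical
  obtain ⟨n, idx, hidx, hfac⟩ := hL k
  -- Each index is represented by the policy at a chosen data point of its fibre; the value `0` at
  -- unattained indices is never used.
  let Ψ : ((Fin k → (Fin (H + 1) → 𝒳) × (Fin H → 𝒜)) × Fin n) × Traj 𝒳 𝒴 𝒜 H → ℝ≥0∞ :=
    fun q => if h : ∃ p, idx p = q.1.2 then Φ q.1.1 (L k h.choose) q.2 else 0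
  have hΨ : Measurable Ψ := by
    refine measurable_from_prod_countable_right fun s => ?_
    by_cases h : ∃ p, idx p = s.2
    · simpa only [Ψ, h, dite_true] using hΦ s.1 (L k h.choose)
    · simpa only [Ψ, h, dite_false] using measurable_const
  have heq : (fun q : (Fin k → Traj 𝒳 𝒴 𝒜 H) × Traj 𝒳 𝒴 𝒜 H =>
      Φ (skeleton q.1) (L k q.1) q.2) = fun q => Ψ ((skeleton q.1, idx q.1), q.2) := by
    funext q
    have h : ∃ p, idx p = idx q.1 := ⟨_, rfl⟩
    simp only [Ψ, h, dite_true]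
    rw [hfac h.choose_spec]
  rw [heq]
  exact hΨ.comp (((measurable_skeleton.comp measurable_fst).prodMk
    (hidx.comp measurable_fst)).prodMk measurable_snd)

theorem measurable_trajDensity (M : POMDP 𝒳 𝒜 ν) (π : Policy 𝒴 𝒜 H) :
    Measurable (trajDensity M π) := by
  rw [trajDensity_eq_trajWeight]
  exact measurable_trajWeight _ (fun x => (M.emit.measurable_density x).coe_nnreal_ennreal) _ π

theorem lintegral_trajDensity [SigmaFinite ν] (M : POMDP 𝒳 𝒜 ν) (π : Policy 𝒴 𝒜 H) :
    ∫⁻ τ, trajDensity M π τ ∂(trajRef ν) = 1 :=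
  lintegral_trajWeight_eq_one _ (fun x => (M.emit.measurable_density x).coe_nnreal_ennreal)
    M.emit.lintegral_density (fun _ _ => sum_pmf _) π

theorem dataLaw_univ [SigmaFinite ν] (M : POMDP 𝒳 𝒜 ν) {L : Learner 𝒳 𝒴 𝒜 H} (hL : L.IsSimple)
    (K : ℕ) : dataLaw M L K Set.univ = 1 := by
  unfold dataLaw
  rw [withDensity_apply' _ Set.univ, setLIntegral_univ]
  exact lintegral_prod_past_eq_one (trajRef ν) (f := fun k p τ => trajDensity M (L k p) τ)
    (fun k => hL.measurable (Φ := fun _ π τ => trajDensity M π τ)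
      fun _ π => measurable_trajDensity M π)
    (fun k p => lintegral_trajDensity M (L k p)) K

/-- Change of measure: a set on which the data density is at most `c` times a product of
conditional sub-densities has probability at most `c`. -/
theorem dataLaw_le_of_density_le [SigmaFinite ν] (M : POMDP 𝒳 𝒜 ν) (L : Learner 𝒳 𝒴 𝒜 H)
    {K : ℕ} {f : (k : ℕ) → (Fin k → Traj 𝒳 𝒴 𝒜 H) → Traj 𝒳 𝒴 𝒜 H → ℝ≥0∞}
    (hf : ∀ k, Measurable fun q : (Fin k → Traj 𝒳 𝒴 𝒜 H) × Traj 𝒳 𝒴 𝒜 H => f k q.1 q.2)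
    (h1 : ∀ k p, ∫⁻ τ, f k p τ ∂(trajRef ν) ≤ 1) (c : ℝ≥0∞)
    {S : Set (Fin K → Traj 𝒳 𝒴 𝒜 H)}
    (hS : ∀ D ∈ S, ∏ k : Fin K, trajDensity M (L k (past D k)) (D k) ≤
      c * ∏ k : Fin K, f k (past D k) (D k)) : dataLaw M L K S ≤ c := by
  have hm : Measurable fun D : Fin K → Traj 𝒳 𝒴 𝒜 H => ∏ k : Fin K, f k (past D k) (D k) :=
    Finset.measurable_prod _ fun k _ =>
      (hf k).comp (f := fun D : Fin K → Traj 𝒳 𝒴 𝒜 H => (past D k, D k))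
        (Measurable.prodMk (by unfold past; fun_prop) (by fun_prop))
  unfold dataLaw
  rw [withDensity_apply' _ S]
  calc _ ≤ ∫⁻ D in S, c * ∏ k : Fin K, f k (past D k) (D k)
        ∂(Measure.pi fun _ => trajRef ν) := setLIntegral_mono (hm.const_mul c) hS
    _ ≤ ∫⁻ D, c * ∏ k : Fin K, f k (past D k) (D k) ∂(Measure.pi fun _ => trajRef ν) :=
        setLIntegral_le_lintegral _ _
    _ = c * ∫⁻ D, ∏ k : Fin K, f k (past D k) (D k) ∂(Measure.pi fun _ => trajRef ν) :=
        lintegral_const_mul _ hm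
    _ ≤ c * 1 := by gcongr; exact lintegral_prod_past_le_one _ hf h1 K
    _ = c := mul_one c

/-- Lets a density comparison for the first `k` rounds be used for all `K`, by leaving the later
rounds untilted. -/
theorem prod_fin_le_of_prod_past_le {K : ℕ} (k : Fin K) {a b : Fin K → ℝ≥0∞} {c : ℝ≥0∞}
    (h : ∀ j, k ≤ j → a j = b j) (hk : ∏ i, past a k i ≤ c * ∏ i, past b k i) :
    ∏ j, a j ≤ c * ∏ j, b j := by
  have split : ∀ u : Fin K → ℝ≥0∞, ∏ j, u j =
      (∏ i, past u k i) * ∏ j with ¬ j < k, u j := by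
    intro u
    rw [← Finset.prod_filter_mul_prod_filter_not Finset.univ (fun j => j < k)]
    congr 1
    symm
    refine Finset.prod_bij (fun i _ => Fin.castLE k.isLt.le i) ?_ ?_ ?_ ?_
    · exact fun i _ => Finset.mem_filter.2 ⟨Finset.mem_univ _, i.isLt⟩
    · intro i _ j _ hij
      exact Fin.castLE_injective _ hij
    · intro j hj
      have : j < k := by simpa using hj
      exact ⟨⟨j, this⟩, Finset.mem_univ _, rfl⟩
    · intro i _
      rfl
  rw [split a, split b, ← mul_assoc]
  refine mul_le_mul' hk (Finset.prod_le_prod' fun j hj => (h j ?_).le)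
  simpa using hj

end Data

/-! ### Values and the simulation lemma. -/

section Values

set_option linter.unusedSectionVars false

variable {𝒳 𝒴 𝒜 : Type*} [Fintype 𝒳] [MeasurableSpace 𝒳] [DiscreteMeasurableSpace 𝒳]
  [Fintype 𝒜] [MeasurableSpace 𝒜] [DiscreteMeasurableSpace 𝒜] [MeasurableSpace 𝒴]
  {ν : Measure 𝒴} {H : ℕ}

theorem isProbabilityMeasure_trajLaw [SigmaFinite ν] (M : POMDP 𝒳 𝒜 ν) (π : Policy 𝒴 𝒜 H) :
    IsProbabilityMeasure (trajLaw M π) := by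
  refine ⟨?_⟩
  unfold trajLaw
  rw [withDensity_apply _ MeasurableSet.univ, setLIntegral_univ, lintegral_trajDensity]

theorem integrable_of_latent_action [SigmaFinite ν] (M : POMDP 𝒳 𝒜 ν) (π : Policy 𝒴 𝒜 H)
    (f : (Fin (H + 1) → 𝒳) → (Fin H → 𝒜) → ℝ) :
    Integrable (fun τ => f τ.1 τ.2.2) (trajLaw M π) := by
  have := isProbabilityMeasure_trajLaw M π
  refine Integrable.of_bound (C := ∑ q : (Fin (H + 1) → 𝒳) × (Fin H → 𝒜), ‖f q.1 q.2‖)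
    (measurable_of_latent_action f).aestronglyMeasurable (ae_of_all _ fun τ => ?_)
  exact Finset.single_le_sum (f := fun q : (Fin (H + 1) → 𝒳) × (Fin H → 𝒜) => ‖f q.1 q.2‖)
    (fun q _ => norm_nonneg _) (Finset.mem_univ (τ.1, τ.2.2))

/-- The cumulative reward along a trajectory. -/
def pathReward (r : 𝒳 → 𝒜 → ℝ) (τ : Traj 𝒳 𝒴 𝒜 H) : ℝ :=
  ∑ h : Fin H, r (τ.1 h.castSucc) (τ.2.2 h)

theorem integrable_pathReward [SigmaFinite ν] (M : POMDP 𝒳 𝒜 ν) (π : Policy 𝒴 𝒜 H)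
    (r : 𝒳 → 𝒜 → ℝ) : Integrable (pathReward r) (trajLaw M π) :=
  integrable_of_latent_action M π fun xs as => ∑ h : Fin H, r (xs h.castSucc) (as h)

theorem measurable_pathReward (r : 𝒳 → 𝒜 → ℝ) :
    Measurable (pathReward r : Traj 𝒳 𝒴 𝒜 H → ℝ) :=
  measurable_of_latent_action fun xs as => ∑ h : Fin H, r (xs h.castSucc) (as h)

theorem pathReward_nonneg {r : 𝒳 → 𝒜 → ℝ} (hr : ∀ x a, 0 ≤ r x a) (τ : Traj 𝒳 𝒴 𝒜 H) :
    0 ≤ pathReward r τ := Finset.sum_nonneg fun _ _ => hr _ _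

theorem pathReward_le {r : 𝒳 → 𝒜 → ℝ} {b : ℝ} (hr : ∀ x a, r x a ≤ b) (τ : Traj 𝒳 𝒴 𝒜 H) :
    pathReward r τ ≤ H * b :=
  (Finset.sum_le_sum fun _ _ => hr _ _).trans (by simp)

theorem value_eq_integral (ρ : PMF 𝒳) (T : 𝒳 → 𝒜 → PMF 𝒳) (O : Emission 𝒳 ν) (r r' : 𝒳 → 𝒜 → ℝ)
    (π : Policy 𝒴 𝒜 H) : value ⟨ρ, T, O, r⟩ π = ∫ τ, pathReward r τ ∂(trajLaw ⟨ρ, T, O, r'⟩ π) :=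
  rfl

theorem value_add [SigmaFinite ν] (ρ : PMF 𝒳) (T : 𝒳 → 𝒜 → PMF 𝒳) (O : Emission 𝒳 ν)
    (r s : 𝒳 → 𝒜 → ℝ) (π : Policy 𝒴 𝒜 H) :
    value ⟨ρ, T, O, fun x a => r x a + s x a⟩ π =
      value ⟨ρ, T, O, r⟩ π + value ⟨ρ, T, O, s⟩ π := by
  rw [value_eq_integral _ _ _ _ r, value_eq_integral _ _ _ r r, value_eq_integral _ _ _ s r,
    ← integral_add (integrable_pathReward _ _ _) (integrable_pathReward _ _ _)]
  simp [pathReward, Finset.sum_add_distrib]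

theorem value_const_mul (ρ : PMF 𝒳) (T : 𝒳 → 𝒜 → PMF 𝒳) (O : Emission 𝒳 ν)
    (c : ℝ) (r : 𝒳 → 𝒜 → ℝ) (π : Policy 𝒴 𝒜 H) :
    value ⟨ρ, T, O, fun x a => c * r x a⟩ π = c * value ⟨ρ, T, O, r⟩ π := by
  rw [value_eq_integral _ _ _ _ r, value_eq_integral _ _ _ r r, ← integral_const_mul]
  simp [pathReward, Finset.mul_sum]

theorem value_mono [SigmaFinite ν] (ρ : PMF 𝒳) (T : 𝒳 → 𝒜 → PMF 𝒳) (O : Emission 𝒳 ν)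
    {r s : 𝒳 → 𝒜 → ℝ} (h : ∀ x a, r x a ≤ s x a) (π : Policy 𝒴 𝒜 H) :
    value ⟨ρ, T, O, r⟩ π ≤ value ⟨ρ, T, O, s⟩ π := by
  rw [value_eq_integral _ _ _ _ r, value_eq_integral _ _ _ s r]
  exact integral_mono (integrable_pathReward _ _ _) (integrable_pathReward _ _ _)
    fun τ => Finset.sum_le_sum fun _ _ => h _ _

theorem value_nonneg (M : POMDP 𝒳 𝒜 ν) (h : ∀ x a, 0 ≤ M.reward x a) (π : Policy 𝒴 𝒜 H) :
    0 ≤ value M π :=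
  integral_nonneg fun τ => pathReward_nonneg h τ

theorem value_le [SigmaFinite ν] (M : POMDP 𝒳 𝒜 ν) {b : ℝ} (h : ∀ x a, M.reward x a ≤ b)
    (π : Policy 𝒴 𝒜 H) : value M π ≤ H * b := by
  have := isProbabilityMeasure_trajLaw M π
  calc value M π ≤ ∫ _, (H * b : ℝ) ∂(trajLaw M π) :=
        integral_mono (integrable_pathReward M π M.reward) (integrable_const _)
          fun τ => pathReward_le h τ
    _ = H * b := by simp

theorem ofReal_value [SigmaFinite ν] (M : POMDP 𝒳 𝒜 ν) (h : ∀ x a, 0 ≤ M.reward x a)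
    (π : Policy 𝒴 𝒜 H) : ENNReal.ofReal (value M π) =
      ∫⁻ τ, trajDensity M π τ * ENNReal.ofReal (pathReward M.reward τ) ∂(trajRef ν) := by
  have := ofReal_integral_eq_lintegral_ofReal (integrable_pathReward M π M.reward)
    (ae_of_all _ fun τ => pathReward_nonneg h τ)
  rw [show value M π = ∫ τ, pathReward M.reward τ ∂(trajLaw M π) from rfl, this, trajLaw,
    lintegral_withDensity_eq_lintegral_mul _ (measurable_trajDensity M π)
      (measurable_pathReward _).ennreal_ofReal]
  rfl

/-- Simulation lemma: the value under a second model exceeds the value under the first by at most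
the largest return times the expected sum of the one-step discrepancies, the expectation being
taken under the first model. -/
theorem value_le_value_add_discrepancy [SigmaFinite ν] (ρ : PMF 𝒳) (T T' : 𝒳 → 𝒜 → PMF 𝒳)
    (O O' : Emission 𝒳 ν) {r : 𝒳 → 𝒜 → ℝ} {b : ℝ} (hr : ∀ x a, 0 ≤ r x a)
    (hb : ∀ x a, r x a ≤ b) (hb0 : 0 ≤ b) {dO : 𝒳 → ℝ} {dT : 𝒳 → 𝒜 → ℝ} (hO0 : ∀ x, 0 ≤ dO x)
    (hT0 : ∀ x a, 0 ≤ dT x a)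
    (hO : ∀ x, ∫⁻ y, ((O'.density x y : ℝ≥0∞) - O.density x y) ∂ν ≤ ENNReal.ofReal (dO x))
    (hT : ∀ x a, ∑ x', (T' x a x' - T x a x') ≤ ENNReal.ofReal (dT x a)) (π : Policy 𝒴 𝒜 H) :
    value ⟨ρ, T', O', r⟩ π ≤ value ⟨ρ, T, O, r⟩ π +
      H * b * value ⟨ρ, T, O, fun x a => dO x + dT x a⟩ π := by
  set M : POMDP 𝒳 𝒜 ν := ⟨ρ, T, O, r⟩
  set M' : POMDP 𝒳 𝒜 ν := ⟨ρ, T', O', r⟩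
  set Md : POMDP 𝒳 𝒜 ν := ⟨ρ, T, O, fun x a => dO x + dT x a⟩
  have hd0 : ∀ x a, 0 ≤ dO x + dT x a := fun x a => add_nonneg (hO0 x) (hT0 x a)
  have hvd : 0 ≤ value Md π := value_nonneg Md hd0 π
  have hv : 0 ≤ value M π := value_nonneg M hr π
  have hHb : (0 : ℝ) ≤ H * b := by positivity
  refine (ENNReal.ofReal_le_ofReal_iff (by positivity)).1 ?_
  rw [ENNReal.ofReal_add hv (by positivity), ENNReal.ofReal_mul hHb, ofReal_value M' hr,
    ofReal_value M hr, ofReal_value Md hd0]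
  have hmM := measurable_trajDensity M π
  have hmM' := measurable_trajDensity M' π
  have hmr := (measurable_pathReward (H := H) (𝒴 := 𝒴) r).ennreal_ofReal
  have hsim := lintegral_trajWeight_tsub_le (ν := ν) ρ
    (fun x => (O.measurable_density x).coe_nnreal_ennreal) O.lintegral_density
    (fun x => (O'.measurable_density x).coe_nnreal_ennreal) O'.lintegral_density
    (T := fun x a x' => T x a x') (T' := fun x a x' => T' x a x')
    (fun _ _ => sum_pmf _) (fun _ _ => sum_pmf _) hO hT π
  -- The second density is at most the first plus its positive excess, and on the excess the return
  -- is bounded by `H * b`.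
  calc _ ≤ ∫⁻ τ, (trajDensity M π τ * ENNReal.ofReal (pathReward r τ) +
          ENNReal.ofReal (H * b) * (trajDensity M' π τ - trajDensity M π τ)) ∂(trajRef ν) := by
        refine lintegral_mono fun τ => ?_
        calc trajDensity M' π τ * ENNReal.ofReal (pathReward r τ)
            ≤ (trajDensity M π τ + (trajDensity M' π τ - trajDensity M π τ)) *
              ENNReal.ofReal (pathReward r τ) := by gcongr; exact le_add_tsub
          _ = _ := add_mul _ _ _
          _ ≤ _ := by
            rw [mul_comm (ENNReal.ofReal (H * b))]
            gcongr
            exact pathReward_le hb τ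
    _ = ∫⁻ τ, trajDensity M π τ * ENNReal.ofReal (pathReward r τ) ∂(trajRef ν) +
          ENNReal.ofReal (H * b) *
            ∫⁻ τ, (trajDensity M' π τ - trajDensity M π τ) ∂(trajRef ν) := by
        rw [lintegral_add_left (hmM.fun_mul hmr), lintegral_const_mul _ (hmM'.fun_sub hmM)]
    _ ≤ _ := by
        refine add_le_add le_rfl (mul_le_mul' le_rfl ?_)
        refine hsim.trans (le_of_eq (lintegral_congr fun τ => ?_))
        congr 1
        show pathCost _ _ τ = ENNReal.ofReal (∑ h : Fin H, _)
        rw [ENNReal.ofReal_sum_of_nonneg fun h _ => hd0 _ _]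
        exact Finset.sum_congr rfl fun h _ => (ENNReal.ofReal_add (hO0 _) (hT0 _ _)).symm

end Values

/-! ### From expected to collected bonuses. -/

section Concentration

set_option linter.unusedSectionVars false

variable {𝒳 𝒴 𝒜 : Type*} [Fintype 𝒳] [MeasurableSpace 𝒳] [DiscreteMeasurableSpace 𝒳]
  [Fintype 𝒜] [MeasurableSpace 𝒜] [DiscreteMeasurableSpace 𝒜] [MeasurableSpace 𝒴]
  {ν : Measure 𝒴} {H : ℕ}

theorem exp_neg_le_one_sub_half {z : ℝ} (h0 : 0 ≤ z) (h1 : z ≤ 1) :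
    Real.exp (-z) ≤ 1 - z / 2 := by
  rw [Real.exp_neg, inv_le_iff_one_le_mul₀ (Real.exp_pos z)]
  have h2 := Real.quadratic_le_exp_of_nonneg h0
  calc (1 : ℝ) ≤ (1 - z / 2) * (1 + z + z ^ 2 / 2) := by
        have : 0 ≤ z * (1 - z) := mul_nonneg h0 (by linarith)
        nlinarith [mul_nonneg h0 (mul_nonneg h0 (sub_nonneg.2 h1))]
    _ ≤ _ := mul_le_mul_of_nonneg_left h2 (by linarith)

/-- For a variable `Y` in `[0, 1]` with mean `v`, the bound `exp (-z) ≤ 1 - z / 2` gives `E exp (-Y)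
≤ 1 - v / 2 ≤ exp (-v / 2)`. No variance term appears; the price is the factor two between expected
and collected rewards. -/
theorem lintegral_trajDensity_mul_exp_le [SigmaFinite ν] (M : POMDP 𝒳 𝒜 ν) (π : Policy 𝒴 𝒜 H)
    {r : 𝒳 → 𝒜 → ℝ} (h0 : ∀ x a, 0 ≤ r x a) (h1 : ∀ x a, H * r x a ≤ 1) :
    ∫⁻ τ, trajDensity M π τ * ENNReal.ofReal (Real.exp
      (value ⟨M.init, M.trans, M.emit, r⟩ π / 2 - pathReward r τ)) ∂(trajRef ν) ≤ 1 := by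
  set v := value ⟨M.init, M.trans, M.emit, r⟩ π with hv
  have hv0 : 0 ≤ v := value_nonneg ⟨M.init, M.trans, M.emit, r⟩ h0 π
  have hm := measurable_trajDensity M π
  have hmr := measurable_pathReward (H := H) (𝒴 := 𝒴) r
  have hr1 : ∀ τ : Traj 𝒳 𝒴 𝒜 H, pathReward r τ ≤ 1 := by
    intro τ
    rcases Nat.eq_zero_or_pos H with rfl | hH
    · simp [pathReward]
    · have hH' : (0 : ℝ) < H := by exact_mod_cast hH
      calc pathReward r τ ≤ H * (1 / H) :=
            pathReward_le (fun x a => by rw [le_div_iff₀ hH', mul_comm]; exact h1 x a) τ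
        _ = 1 := by field_simp
  have hE : ∫⁻ τ, trajDensity M π τ * ENNReal.ofReal (Real.exp (-pathReward r τ)) ∂(trajRef ν) +
      ENNReal.ofReal (v / 2) ≤ 1 := by
    have : ENNReal.ofReal (v / 2) =
        ∫⁻ τ, trajDensity M π τ * ENNReal.ofReal (pathReward r τ) * ENNReal.ofReal (1 / 2)
          ∂(trajRef ν) := by
      rw [lintegral_mul_const _ (hm.fun_mul hmr.ennreal_ofReal), div_eq_mul_one_div,
        ENNReal.ofReal_mul hv0, hv, ofReal_value _ h0]
      rfl
    rw [this, ← lintegral_add_left (hm.fun_mul hmr.fun_neg.exp.ennreal_ofReal),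
      ← lintegral_trajDensity M π]
    refine lintegral_mono fun τ => ?_
    rw [mul_assoc, ← mul_add, ← ENNReal.ofReal_mul (pathReward_nonneg h0 τ),
      ← ENNReal.ofReal_add (Real.exp_pos _).le
        (mul_nonneg (pathReward_nonneg h0 τ) (by norm_num))]
    refine mul_le_of_le_one_right' (ENNReal.ofReal_le_one.2 ?_)
    have := exp_neg_le_one_sub_half (pathReward_nonneg h0 τ) (hr1 τ)
    linarith
  have hle : ∫⁻ τ, trajDensity M π τ * ENNReal.ofReal (Real.exp (-pathReward r τ)) ∂(trajRef ν) ≤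
      ENNReal.ofReal (Real.exp (-(v / 2))) := by
    refine (ENNReal.le_sub_of_add_le_right ENNReal.ofReal_ne_top hE).trans ?_
    rw [← ENNReal.ofReal_one, ← ENNReal.ofReal_sub _ (by positivity)]
    refine ENNReal.ofReal_le_ofReal ?_
    have := Real.add_one_le_exp (-(v / 2))
    linarith
  calc _ = ENNReal.ofReal (Real.exp (v / 2)) *
        ∫⁻ τ, trajDensity M π τ * ENNReal.ofReal (Real.exp (-pathReward r τ)) ∂(trajRef ν) := by
        rw [← lintegral_const_mul _ (hm.fun_mul hmr.fun_neg.exp.ennreal_ofReal)]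
        refine lintegral_congr fun τ => ?_
        rw [sub_eq_add_neg, Real.exp_add, ENNReal.ofReal_mul (Real.exp_pos _).le]
        ring
    _ ≤ ENNReal.ofReal (Real.exp (v / 2)) * ENNReal.ofReal (Real.exp (-(v / 2))) := by gcongr
    _ = 1 := by rw [← ENNReal.ofReal_mul (Real.exp_pos _).le, ← Real.exp_add]; simp

/-- With high probability the conditional expectations of the collected rewards sum up to at most
twice the collected rewards plus a logarithmic term. -/
theorem dataLaw_sum_value_gt_le [SigmaFinite ν] (M : POMDP 𝒳 𝒜 ν) {L : Learner 𝒳 𝒴 𝒜 H}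
    (hL : L.IsSimple) (K : ℕ) {δ b : ℝ} (hδ : 0 < δ) (hb : 0 < b) (hH : 0 < H)
    (R : (k : ℕ) → (Fin k → Traj 𝒳 𝒴 𝒜 H) → 𝒳 → 𝒜 → ℝ)
    (R' : (k : ℕ) → (Fin k → (Fin (H + 1) → 𝒳) × (Fin H → 𝒜)) → 𝒳 → 𝒜 → ℝ)
    (hR : ∀ k p, R k p = R' k (skeleton p))
    (h0 : ∀ k p x a, 0 ≤ R k p x a) (h1 : ∀ k p x a, R k p x a ≤ b) :
    dataLaw M L K {D | 2 * ∑ k : Fin K, pathReward (R k (past D k)) (D k) +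
        2 * (H * b * Real.log (1 / δ)) <
      ∑ k : Fin K, value ⟨M.init, M.trans, M.emit, R k (past D k)⟩ (L k (past D k))} ≤
      ENNReal.ofReal δ := by
  have hH' : (0 : ℝ) < H := by exact_mod_cast hH
  -- `B` bounds the return of an episode; dividing by it brings returns into `[0, 1]`.
  set B : ℝ := H * b with hBdef
  have hB : 0 < B := by positivity
  refine dataLaw_le_of_density_le M L (f := fun k p τ => trajDensity M (L k p) τ *
    ENNReal.ofReal (Real.exp (value ⟨M.init, M.trans, M.emit, fun x a => B⁻¹ * R k p x a⟩ (L k p) / 2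
      - pathReward (fun x a => B⁻¹ * R k p x a) τ))) ?_ ?_ _ ?_
  · intro k
    simp_rw [hR]
    refine hL.measurable (Φ := fun s π τ => trajDensity M π τ * ENNReal.ofReal (Real.exp
      (value ⟨M.init, M.trans, M.emit, fun x a => B⁻¹ * R' k s x a⟩ π / 2
      - pathReward (fun x a => B⁻¹ * R' k s x a) τ))) fun s π => ?_
    exact (measurable_trajDensity M π).mul
      ((measurable_pathReward _).const_sub _).exp.ennreal_ofReal
  · intro k p
    refine lintegral_trajDensity_mul_exp_le M (L k p) (fun x a => ?_) fun x a => ?_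
    · exact mul_nonneg (by positivity) (h0 k p x a)
    · rw [mul_left_comm, inv_mul_le_iff₀ hB, mul_one, hBdef]
      exact mul_le_mul_of_nonneg_left (h1 k p x a) hH'.le
  · intro D hD
    rw [Finset.prod_mul_distrib, ← ENNReal.ofReal_prod_of_nonneg fun _ _ => (Real.exp_pos _).le,
      ← Real.exp_sum, mul_left_comm, ← ENNReal.ofReal_mul hδ.le]
    refine le_mul_of_one_le_right' ?_
    -- What remains is that the accumulated exponent, `B⁻¹` times half the expected minus the
    -- collected rewards, is at least `log (1 / δ)`, and this is how the event is defined.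
    rw [ENNReal.one_le_ofReal, ← div_le_iff₀' hδ, ← Real.log_le_iff_le_exp (by positivity)]
    simp_rw [value_const_mul, Finset.sum_sub_distrib, ← Finset.sum_div, ← Finset.mul_sum]
    have hp : ∀ k : Fin K, pathReward (fun x a => B⁻¹ * R k (past D k) x a) (D k) =
        B⁻¹ * pathReward (R k (past D k)) (D k) := fun k => by
      simp [pathReward, Finset.mul_sum]
    simp_rw [hp, ← Finset.mul_sum]
    have hD' : 2 * ∑ k : Fin K, pathReward (R k (past D k)) (D k) + 2 * (B * Real.log (1 / δ)) <
      ∑ k : Fin K, value ⟨M.init, M.trans, M.emit, R k (past D k)⟩ (L k (past D k)) := hD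
    set V := ∑ k : Fin K, value ⟨M.init, M.trans, M.emit, R k (past D k)⟩ (L k (past D k))
    set Y := ∑ k : Fin K, pathReward (R k (past D k)) (D k)
    rw [mul_div_assoc, ← mul_sub, le_inv_mul_iff₀ hB]
    linarith

end Concentration

/-! ### Accuracy of the empirical transitions. -/

section Transitions

set_option linter.unusedSectionVars false

variable {𝒳 𝒴 𝒜 : Type*} [Fintype 𝒳] [DecidableEq 𝒳] [MeasurableSpace 𝒳]
  [DiscreteMeasurableSpace 𝒳] [Fintype 𝒜] [DecidableEq 𝒜] [MeasurableSpace 𝒜]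
  [DiscreteMeasurableSpace 𝒜] [MeasurableSpace 𝒴] {ν : Measure 𝒴} {H k : ℕ}

theorem transEst_apply (T₁ : 𝒳 → 𝒜 → PMF 𝒳) (D : Fin k → Traj 𝒳 𝒴 𝒜 H) (x : 𝒳) (a : 𝒜) (x' : 𝒳) :
    transEst T₁ D x a x' = if countXA D x a = 0 then T₁ x a x' else
      (countXAX D x a x' : ℝ≥0∞) / (countXA D x a : ℝ≥0∞) := by
  unfold transEst
  split_ifs with h <;> simp

theorem bonus_nonneg (β : ℝ) (n : ℕ) : 0 ≤ bonus β n := by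
  unfold bonus; split_ifs <;> positivity

theorem bonus_le_two (β : ℝ) (n : ℕ) : bonus β n ≤ 2 := by
  unfold bonus; split_ifs
  · exact le_rfl
  · exact min_le_left _ _

theorem countXA_le (D : Fin k → Traj 𝒳 𝒴 𝒜 H) (x : 𝒳) (a : 𝒜) : countXA D x a ≤ k * H := by
  unfold countXA
  calc _ ≤ ∑ l : Fin k, ∑ h : Fin H, 1 := by
        gcongr with l _ h _
        split_ifs <;> simp
    _ = k * H := by simp

theorem toReal_sum_pmf (p : PMF 𝒳) : ∑ x, (p x).toReal = 1 := by
  rw [← ENNReal.toReal_sum fun x _ => p.apply_ne_top x, sum_pmf, ENNReal.toReal_one]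

/-- The exponential tilt of the transitions from `(x, a)` towards the set `S`. -/
def tiltExponent (T : 𝒳 → 𝒜 → PMF 𝒳) (x : 𝒳) (a : 𝒜) (S : Finset 𝒳) (lam : ℝ)
    (z : 𝒳) (c : 𝒜) (z' : 𝒳) : ℝ :=
  if z = x ∧ c = a then
    lam * ((if z' ∈ S then 1 else 0) - ∑ s ∈ S, (T x a s).toReal - lam) else 0

/-- Moment bound for a centred Bernoulli variable of mean `p`: since `exp lam ≤ 1 + lam + lam ^ 2`
on `[0, 1]`, one has `1 + p * (exp lam - 1) ≤ 1 + lam * p + lam ^ 2 ≤ exp (lam * p + lam ^ 2)`. -/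
theorem sum_mul_exp_tiltExponent_le (T : 𝒳 → 𝒜 → PMF 𝒳) (x : 𝒳) (a : 𝒜) (S : Finset 𝒳) {lam : ℝ}
    (h0 : 0 ≤ lam) (h1 : lam ≤ 1) (z : 𝒳) (c : 𝒜) :
    ∑ z', T z c z' * ENNReal.ofReal (Real.exp (tiltExponent T x a S lam z c z')) ≤ 1 := by
  unfold tiltExponent
  by_cases h : z = x ∧ c = a
  swap
  · simp [h, sum_pmf]
  obtain ⟨rfl, rfl⟩ := h
  simp only [and_self, if_true]
  set p := ∑ s ∈ S, (T z c s).toReal with hp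
  have hp0 : 0 ≤ p := Finset.sum_nonneg fun _ _ => ENNReal.toReal_nonneg
  have hp1 : p ≤ 1 := by
    rw [← toReal_sum_pmf (T z c)]
    exact Finset.sum_le_sum_of_subset_of_nonneg (Finset.subset_univ _)
      fun _ _ _ => ENNReal.toReal_nonneg
  have hterm : ∀ z', T z c z' * ENNReal.ofReal
      (Real.exp (lam * ((if z' ∈ S then (1 : ℝ) else 0) - p - lam))) =
      ENNReal.ofReal (Real.exp (-(lam * p + lam ^ 2)) *
        ((T z c z').toReal + if z' ∈ S then (T z c z').toReal * (Real.exp lam - 1) else 0)) := by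
    intro z'
    nth_rewrite 1 [← ENNReal.ofReal_toReal ((T z c).apply_ne_top z')]
    rw [← ENNReal.ofReal_mul ENNReal.toReal_nonneg]
    congr 1
    split_ifs
    · rw [show lam * (1 - p - lam) = -(lam * p + lam ^ 2) + lam by ring, Real.exp_add]; ring
    · rw [show lam * (0 - p - lam) = -(lam * p + lam ^ 2) by ring]; ring
  have hnn : ∀ z', 0 ≤ Real.exp (-(lam * p + lam ^ 2)) *
        ((T z c z').toReal + if z' ∈ S then (T z c z').toReal * (Real.exp lam - 1) else 0) := by
    intro z'
    have := Real.add_one_le_exp lam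
    refine mul_nonneg (Real.exp_pos _).le (add_nonneg ENNReal.toReal_nonneg ?_)
    split_ifs
    · exact mul_nonneg ENNReal.toReal_nonneg (by linarith)
    · exact le_rfl
  simp_rw [hterm]
  rw [← ENNReal.ofReal_sum_of_nonneg fun z' _ => hnn z', ENNReal.ofReal_le_one, ← Finset.mul_sum,
    Finset.sum_add_distrib, toReal_sum_pmf, ← Finset.sum_filter, Finset.filter_mem_eq_inter,
    Finset.univ_inter, ← Finset.sum_mul, ← hp, Real.exp_neg, inv_mul_le_iff₀ (Real.exp_pos _),
    mul_one]
  have h2 := (abs_le.1 (Real.abs_exp_sub_one_sub_id_le (x := lam) (by rwa [abs_of_nonneg h0]))).2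
  have h3 := Real.add_one_le_exp (lam * p + lam ^ 2)
  nlinarith [mul_le_mul_of_nonneg_left h2 hp0, mul_le_mul_of_nonneg_right hp1 (sq_nonneg lam)]

theorem sum_tiltExponent (T : 𝒳 → 𝒜 → PMF 𝒳) (x : 𝒳) (a : 𝒜) (S : Finset 𝒳) (lam : ℝ)
    (D : Fin k → Traj 𝒳 𝒴 𝒜 H) :
    ∑ l, ∑ h : Fin H,
      tiltExponent T x a S lam ((D l).1 h.castSucc) ((D l).2.2 h) ((D l).1 h.succ) =
    lam * (∑ s ∈ S, (countXAX D x a s : ℝ) -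
      countXA D x a * ∑ s ∈ S, (T x a s).toReal - countXA D x a * lam) := by
  have h1 : ∑ s ∈ S, (countXAX D x a s : ℝ) = ∑ l, ∑ h : Fin H,
      if (D l).1 h.castSucc = x ∧ (D l).2.2 h = a then
        (if (D l).1 h.succ ∈ S then (1 : ℝ) else 0) else 0 := by
    unfold countXAX
    push_cast
    rw [Finset.sum_comm]
    refine Finset.sum_congr rfl fun l _ => ?_
    rw [Finset.sum_comm]
    refine Finset.sum_congr rfl fun h _ => ?_
    by_cases h1 : (D l).1 h.castSucc = x <;> by_cases h2 : (D l).2.2 h = a <;> simp [h1, h2]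
  have h2 : (countXA D x a : ℝ) = ∑ l, ∑ h : Fin H,
      if (D l).1 h.castSucc = x ∧ (D l).2.2 h = a then (1 : ℝ) else 0 := by
    unfold countXA; push_cast; rfl
  unfold tiltExponent
  generalize ∑ s ∈ S, (T x a s).toReal = p
  rw [h1, h2]
  simp_rw [Finset.sum_mul, ← Finset.sum_sub_distrib, Finset.mul_sum]
  refine Finset.sum_congr rfl fun l _ => Finset.sum_congr rfl fun h _ => ?_
  split_ifs <;> ring

theorem trajWeight_mul_trans (ρ : PMF 𝒳) (E : 𝒳 → 𝒴 → ℝ≥0∞) (T g : 𝒳 → 𝒜 → 𝒳 → ℝ≥0∞)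
    (π : Policy 𝒴 𝒜 H) (τ : Traj 𝒳 𝒴 𝒜 H) :
    trajWeight ρ E (fun x a x' => T x a x' * g x a x') π τ =
      trajWeight ρ E T π τ * ∏ h : Fin H, g (τ.1 h.castSucc) (τ.2.2 h) (τ.1 h.succ) := by
  unfold trajWeight
  rw [mul_assoc, ← Finset.prod_mul_distrib]
  simp_rw [mul_assoc]

theorem measurable_and_lintegral_switch [SigmaFinite ν] (M : POMDP 𝒳 𝒜 ν) {L : Learner 𝒳 𝒴 𝒜 H}
    (hL : L.IsSimple) (k : ℕ) {E : 𝒳 → 𝒴 → ℝ≥0∞} (hE : ∀ x, Measurable (E x))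
    (hE1 : ∀ x, ∫⁻ y, E x y ∂ν ≤ 1) {T : 𝒳 → 𝒜 → 𝒳 → ℝ≥0∞} (hT : ∀ x a, ∑ x', T x a x' ≤ 1) :
    (∀ j, Measurable fun q : (Fin j → Traj 𝒳 𝒴 𝒜 H) × Traj 𝒳 𝒴 𝒜 H =>
      if j < k then trajWeight M.init E T (L j q.1) q.2 else trajDensity M (L j q.1) q.2) ∧
    ∀ j (p : Fin j → Traj 𝒳 𝒴 𝒜 H),
      ∫⁻ τ, (if j < k then trajWeight M.init E T (L j p) τ else trajDensity M (L j p) τ)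
        ∂(trajRef ν) ≤ 1 := by
  refine ⟨fun j => ?_, fun j p => ?_⟩
  · split_ifs
    · exact hL.measurable (Φ := fun _ π τ => trajWeight M.init E T π τ)
        fun _ π => measurable_trajWeight _ hE _ π
    · exact hL.measurable (Φ := fun _ π τ => trajDensity M π τ)
        fun _ π => measurable_trajDensity M π
  · split_ifs
    · exact lintegral_trajWeight_le_one _ hE hE1 hT _
    · exact (lintegral_trajDensity M _).le

/-- Change of measure restricted to the first `k` rounds. -/
theorem dataLaw_le_of_past_le [SigmaFinite ν] (M : POMDP 𝒳 𝒜 ν) {L : Learner 𝒳 𝒴 𝒜 H}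
    (hL : L.IsSimple) {K : ℕ} (k : Fin K) {E : 𝒳 → 𝒴 → ℝ≥0∞} (hE : ∀ x, Measurable (E x))
    (hE1 : ∀ x, ∫⁻ y, E x y ∂ν ≤ 1) {T : 𝒳 → 𝒜 → 𝒳 → ℝ≥0∞} (hT : ∀ x a, ∑ x', T x a x' ≤ 1)
    (c : ℝ≥0∞) {S : Set (Fin K → Traj 𝒳 𝒴 𝒜 H)}
    (hS : ∀ D ∈ S, ∀ π : Fin k → Policy 𝒴 𝒜 H,
      ∏ l, trajDensity M (π l) (past D k l) ≤ c * ∏ l, trajWeight M.init E T (π l) (past D k l)) :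
    dataLaw M L K S ≤ c := by
  obtain ⟨hm, h1⟩ := measurable_and_lintegral_switch M hL k hE hE1 hT
  refine dataLaw_le_of_density_le M L hm h1 c fun D hD => ?_
  refine prod_fin_le_of_prod_past_le k (fun j hj => ?_) ?_
  · simp only [if_neg (not_lt.2 (Fin.le_def.1 hj))]
  · refine (hS D hD (past (fun j : Fin K => L j (past D j)) k)).trans (le_of_eq ?_)
    congr 1
    refine Finset.prod_congr rfl fun l _ => ?_
    exact (if_pos l.isLt).symm

/-- A Chernoff bound with a random number of visits: the tilt acts only at visits to `(x, a)`, so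
the ratio of tilted to true density is the exponential of the quantity in the event. -/
theorem dataLaw_tilt_le [SigmaFinite ν] (M : POMDP 𝒳 𝒜 ν) {L : Learner 𝒳 𝒴 𝒜 H}
    (hL : L.IsSimple) {K : ℕ} (k : Fin K) (x : 𝒳) (a : 𝒜) (S : Finset 𝒳) {lam : ℝ}
    (h0 : 0 ≤ lam) (h1 : lam ≤ 1) (t : ℝ) :
    dataLaw M L K {D | t ≤ lam * (∑ s ∈ S, (countXAX (past D k) x a s : ℝ) -
      countXA (past D k) x a * ∑ s ∈ S, (M.trans x a s).toReal - countXA (past D k) x a * lam)} ≤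
      ENNReal.ofReal (Real.exp (-t)) := by
  refine dataLaw_le_of_past_le M hL k
    (fun x => (M.emit.measurable_density x).coe_nnreal_ennreal)
    (fun x => (M.emit.lintegral_density x).le)
    (T := fun z c z' => M.trans z c z' *
      ENNReal.ofReal (Real.exp (tiltExponent M.trans x a S lam z c z')))
    (fun z c => sum_mul_exp_tiltExponent_le M.trans x a S h0 h1 z c) _ fun D hD π => ?_
  simp_rw [trajWeight_mul_trans M.init _ (fun z c z' => M.trans z c z'),
    ← trajDensity_eq_trajWeight]
  rw [Finset.prod_mul_distrib]
  simp_rw [← ENNReal.ofReal_prod_of_nonneg fun _ _ => (Real.exp_pos _).le, ← Real.exp_sum]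
  rw [← ENNReal.ofReal_prod_of_nonneg fun _ _ => (Real.exp_pos _).le, ← Real.exp_sum,
    sum_tiltExponent, mul_left_comm, ← ENNReal.ofReal_mul (Real.exp_pos _).le, ← Real.exp_add]
  refine le_mul_of_one_le_right' ?_
  rw [ENNReal.one_le_ofReal, Real.one_le_exp_iff]
  have : t ≤ _ := hD
  linarith

/-- The one-sided discrepancy is attained on a single event, which reduces it to frequencies of
subsets of `𝒳`. -/
theorem sum_tsub_eq_ofReal (p q : PMF 𝒳) :
    ∑ x, (p x - q x) = ENNReal.ofReal (∑ x with q x < p x, (p x).toReal -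
      ∑ x with q x < p x, (q x).toReal) := by
  rw [← Finset.sum_sub_distrib, ENNReal.ofReal_sum_of_nonneg, Finset.sum_filter]
  · refine Finset.sum_congr rfl fun x _ => ?_
    split_ifs with h
    · rw [ENNReal.ofReal_sub _ ENNReal.toReal_nonneg, ENNReal.ofReal_toReal (p.apply_ne_top x),
        ENNReal.ofReal_toReal (q.apply_ne_top x)]
    · exact tsub_eq_zero_of_le (not_lt.1 h)
  · intro x hx
    rw [sub_nonneg]
    exact ENNReal.toReal_mono (p.apply_ne_top x) (Finset.mem_filter.1 hx).2.le

theorem sum_tsub_le_one (p q : PMF 𝒳) : ∑ x, (p x - q x) ≤ 1 :=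
  (Finset.sum_le_sum fun _ _ => tsub_le_self).trans (sum_pmf p).le

theorem sum_tsub_comm (p q : PMF 𝒳) : ∑ x, (p x - q x) = ∑ x, (q x - p x) := by
  have h : ∑ x, p x + ∑ x, (q x - p x) = ∑ x, q x + ∑ x, (p x - q x) := by
    rw [← Finset.sum_add_distrib, ← Finset.sum_add_distrib]
    exact Finset.sum_congr rfl fun x _ => by rw [add_tsub_eq_max, add_tsub_eq_max, max_comm]
  rw [sum_pmf, sum_pmf] at h
  exact ((ENNReal.add_right_inj ENNReal.one_ne_top).1 h).symm

theorem one_le_card_mul {X A K H : ℕ} {δ : ℝ} (hX : 1 ≤ X) (hA : 1 ≤ A) (hK : 1 ≤ K) (hH : 1 ≤ H)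
    (hδ : 0 < δ) (hδ1 : δ < 1) : 1 < (X : ℝ) ^ 2 * A * K * H / δ := by
  rw [lt_div_iff₀ hδ, one_mul]
  refine hδ1.trans_le ?_
  have : 1 ≤ X ^ 2 * A * K * H := Nat.one_le_iff_ne_zero.2 (by positivity)
  exact_mod_cast this

theorem union_bound_transitions {X A K H : ℕ} {δ : ℝ} (hX : 2 ≤ X) (hA : 1 ≤ A) (hK : 1 ≤ K)
    (hH : 1 ≤ H) (hδ : 0 < δ) (hδ1 : δ < 1) :
    ((K * (X * (A * (2 ^ X * (K * H)))) : ℕ) : ℝ) *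
      Real.exp (-(2 * X * Real.log ((X : ℝ) ^ 2 * A * K * H / δ))) ≤ δ := by
  set Z := (X : ℝ) ^ 2 * A * K * H / δ with hZ
  have hX' : (2 : ℝ) ≤ X := by exact_mod_cast hX
  have hA' : (1 : ℝ) ≤ A := by exact_mod_cast hA
  have hK' : (1 : ℝ) ≤ K := by exact_mod_cast hK
  have hH' : (1 : ℝ) ≤ H := by exact_mod_cast hH
  set W := (X : ℝ) ^ 2 * A * K * H with hW
  have hW4 : 4 ≤ W := by
    calc (4 : ℝ) = 2 ^ 2 * 1 * 1 * 1 := by norm_num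
      _ ≤ W := by rw [hW]; gcongr
  have hZ4 : 4 ≤ Z := by
    rw [hZ, le_div_iff₀ hδ]; nlinarith
  have hZ0 : 0 < Z := by linarith
  have hexp : Real.exp (-(2 * X * Real.log Z)) = ((Z ^ 2)⁻¹) ^ X := by
    rw [show -(2 * X * Real.log Z) = X * -(2 * Real.log Z) by ring, Real.exp_nat_mul, Real.exp_neg]
    congr 2
    rw [show (2 : ℝ) * Real.log Z = ((2 : ℕ) : ℝ) * Real.log Z by norm_num, Real.exp_nat_mul,
      Real.exp_log hZ0]
  rw [hexp]
  -- The exponent `X` absorbs the `2 ^ X` subsets. The base is at most one, so `X ≥ 2` leaves `4 / Z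
  -- ^ 4`, enough against the remaining count `W ^ 2`.
  have hpow : (2 * (Z ^ 2)⁻¹) ^ X ≤ (2 * (Z ^ 2)⁻¹) ^ 2 := by
    refine pow_le_pow_of_le_one (by positivity) ?_ hX
    rw [← div_eq_mul_inv, div_le_one (by positivity)]
    nlinarith
  have hcount : (K : ℝ) * (X * (A * (K * H))) ≤ W ^ 2 := by
    have : K * (X * (A * (K * H))) ≤ (X ^ 2 * A * K * H) ^ 2 := by
      calc K * (X * (A * (K * H))) = X ^ 1 * A ^ 1 * K ^ 2 * H ^ 1 := by ring
        _ ≤ X ^ 4 * A ^ 2 * K ^ 2 * H ^ 2 := by gcongr <;> omega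
        _ = _ := by ring
    rw [hW]
    exact_mod_cast this
  calc _ = (K : ℝ) * (X * (A * (K * H))) * (2 * (Z ^ 2)⁻¹) ^ X := by
        push_cast; rw [mul_pow]; ring
    _ ≤ W ^ 2 * (2 * (Z ^ 2)⁻¹) ^ 2 := by gcongr
    _ = (W / Z) ^ 2 * (4 / Z ^ 2) := by field_simp; norm_num
    _ = δ ^ 2 * (4 / Z ^ 2) := by
        congr 2; rw [hZ]; field_simp
    _ ≤ δ * 1 := by
        gcongr
        · nlinarith
        · rw [div_le_one (by positivity)]; nlinarith
    _ = δ := mul_one δ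

/-- With high probability the transition estimates stay within the transition bonus. -/
theorem dataLaw_transEst_bad_le [SigmaFinite ν] (M : POMDP 𝒳 𝒜 ν) {L : Learner 𝒳 𝒴 𝒜 H}
    (hL : L.IsSimple) {K : ℕ} {δ : ℝ} (hA : 1 ≤ Fintype.card 𝒜) (hK : 1 ≤ K) (hH : 1 ≤ H)
    (hδ : 0 < δ) (hδ1 : δ < 1) (T₁ : 𝒳 → 𝒜 → PMF 𝒳) :
    dataLaw M L K {D | ∃ k : Fin K, ∃ x a, ENNReal.ofReal (bonusXA K δ (past D k) x a) <
      ∑ x', (transEst T₁ (past D k) x a x' - M.trans x a x')} ≤ ENNReal.ofReal δ := by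
  have hX1 : 1 ≤ Fintype.card 𝒳 :=
    Fintype.card_pos_iff.2 ⟨M.init.support_nonempty.some⟩
  set X := Fintype.card 𝒳 with hX
  set A := Fintype.card 𝒜
  set Z := (X : ℝ) ^ 2 * A * K * H / δ with hZ
  have hZ1 : 1 < Z := one_le_card_mul hX1 hA hK hH hδ hδ1
  have hlog : 0 < Real.log Z := Real.log_pos hZ1
  set β := 8 * X * Real.log Z with hβ
  have hX0 : (0 : ℝ) < X := by exact_mod_cast hX1
  have hβ0 : 0 < β := by positivity
  -- With a single state all distributions coincide; the union bound below needs at least two.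
  rcases hX1.eq_or_lt with hX1' | hX2
  · have hzero : ∀ p q : PMF 𝒳, ∑ x, (p x - q x) = 0 := by
      intro p q
      obtain ⟨x₀, hx₀⟩ := Fintype.card_eq_one_iff.1 (hX.symm.trans hX1'.symm)
      have hone : ∀ p : PMF 𝒳, p x₀ = 1 := by
        intro p
        rw [← sum_pmf p]
        exact (Finset.sum_eq_single x₀ (fun b _ hb => absurd (hx₀ b) hb) (by simp)).symm
      refine Finset.sum_eq_zero fun x _ => ?_
      rw [hx₀ x, hone p, hone q, tsub_self]
    simp [hzero]
  -- The optimal tilt depends on the random visit count, so the union runs over the possible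
  -- positive counts `n ≤ K * H`, indexed by `n - 1`, as well as over rounds, pairs and subsets.
  set lam : ℕ → ℝ := fun n => min 1 (Real.sqrt (β / n) / 2)
  have hlam0 : ∀ n, 0 ≤ lam n := fun n => le_min zero_le_one (by positivity)
  have hlam1 : ∀ n, lam n ≤ 1 := fun n => min_le_left _ _
  let B : Fin K × 𝒳 × 𝒜 × Finset 𝒳 × Fin (K * H) → Set (Fin K → Traj 𝒳 𝒴 𝒜 H) :=
    fun i => {D | 2 * X * Real.log Z ≤ lam (i.2.2.2.2 + 1) *
      (∑ s ∈ i.2.2.2.1, (countXAX (past D i.1) i.2.1 i.2.2.1 s : ℝ) -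
        countXA (past D i.1) i.2.1 i.2.2.1 *
          ∑ s ∈ i.2.2.2.1, (M.trans i.2.1 i.2.2.1 s).toReal -
        countXA (past D i.1) i.2.1 i.2.2.1 * lam (i.2.2.2.2 + 1))}
  have hB : ∀ i, dataLaw M L K (B i) ≤ ENNReal.ofReal (Real.exp (-(2 * X * Real.log Z))) :=
    fun i => dataLaw_tilt_le M hL i.1 i.2.1 i.2.2.1 i.2.2.2.1 (hlam0 _) (hlam1 _) _
  have hsub : {D | ∃ k : Fin K, ∃ x a, ENNReal.ofReal (bonusXA K δ (past D k) x a) <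
      ∑ x', (transEst T₁ (past D k) x a x' - M.trans x a x')} ⊆ ⋃ i, B i := by
    rintro D ⟨k, x, a, hbad⟩
    set n := countXA (past D k) x a with hn
    -- A one-sided discrepancy never exceeds one. A violation therefore forces a positive count,
    -- which disposes of the arbitrary initial guess, an untruncated bonus, and a tilt below its
    -- cap.
    have hb1 : bonusXA K δ (past D k) x a < 1 := by
      have := hbad.trans_le (sum_tsub_le_one _ _)
      rwa [← ENNReal.ofReal_one, ENNReal.ofReal_lt_ofReal_iff one_pos] at this
    have hn0 : n ≠ 0 := by
      intro h0
      simp only [bonusXA, bonus, ← hn, h0, if_true] at hb1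
      norm_num at hb1
    have hnpos : (0 : ℝ) < n := by exact_mod_cast Nat.pos_of_ne_zero hn0
    have hbeq : bonusXA K δ (past D k) x a = Real.sqrt (β / n) := by
      simp only [bonusXA, bonus, ← hn, hn0, if_false] at hb1 ⊢
      rcases min_choice 2 (Real.sqrt (β / n)) with h | h
      · rw [h] at hb1; norm_num at hb1
      · exact h
    set e := Real.sqrt (β / n) with he
    have he2 : e ^ 2 = β / n := Real.sq_sqrt (by positivity)
    have hepos : 0 < e := Real.sqrt_pos.2 (by positivity)
    rw [hbeq] at hb1 hbad
    set S : Finset 𝒳 := Finset.univ.filter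
      fun x' => M.trans x a x' < transEst T₁ (past D k) x a x' with hS
    rw [sum_tsub_eq_ofReal, ← hS, ENNReal.ofReal_lt_ofReal_iff_of_nonneg hepos.le] at hbad
    have hest : ∑ s ∈ S, (transEst T₁ (past D k) x a s).toReal =
        (∑ s ∈ S, (countXAX (past D k) x a s : ℝ)) / n := by
      rw [Finset.sum_div]
      refine Finset.sum_congr rfl fun s _ => ?_
      rw [transEst_apply, ← hn, if_neg hn0, ENNReal.toReal_div, ENNReal.toReal_natCast,
        ENNReal.toReal_natCast]
    rw [hest] at hbad
    have hnle : n - 1 < K * H := by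
      have h1 := countXA_le (past D k) x a
      have h2 : (k : ℕ) * H ≤ K * H := Nat.mul_le_mul_right H k.isLt.le
      have := Nat.pos_of_ne_zero hn0
      omega
    refine Set.mem_iUnion.2 ⟨(k, x, a, S, ⟨n - 1, hnle⟩), ?_⟩
    show 2 * X * Real.log Z ≤ _
    have hn1 : n - 1 + 1 = n := Nat.sub_add_cancel (Nat.pos_of_ne_zero hn0)
    simp only [hn1, ← hn]
    have hlam : lam n = e / 2 := min_eq_right (by linarith)
    rw [hlam]
    set N := ∑ s ∈ S, (countXAX (past D k) x a s : ℝ)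
    set p := ∑ s ∈ S, (M.trans x a s).toReal
    have h1 : n * e < N - n * p := by
      have : n * e < n * (N / n - p) := mul_lt_mul_of_pos_left hbad hnpos
      rwa [mul_sub, mul_div_cancel₀ _ hnpos.ne'] at this
    have h2 : n * e ^ 2 = β := by rw [he2]; field_simp
    -- The tilt `e / 2` maximizes `lam * (n * e - n * lam)`, with value `n * e ^ 2 / 4 = β / 4`;
    -- this explains the `8` in the bonus.
    calc 2 * X * Real.log Z = e / 2 * (n * e - n * (e / 2)) := by
          rw [show e / 2 * (n * e - n * (e / 2)) = n * e ^ 2 / 4 by ring, h2, hβ]; ring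
      _ ≤ _ := by gcongr
  calc _ ≤ dataLaw M L K (⋃ i, B i) := measure_mono hsub
    _ ≤ ∑ i, dataLaw M L K (B i) := measure_iUnion_fintype_le _ _
    _ ≤ ∑ _i : Fin K × 𝒳 × 𝒜 × Finset 𝒳 × Fin (K * H),
        ENNReal.ofReal (Real.exp (-(2 * X * Real.log Z))) := Finset.sum_le_sum fun i _ => hB i
    _ = ENNReal.ofReal (((K * (X * (A * (2 ^ X * (K * H)))) : ℕ) : ℝ) *
        Real.exp (-(2 * X * Real.log Z))) := by
        rw [Finset.sum_const, Finset.card_univ, nsmul_eq_mul, ENNReal.ofReal_mul (by positivity),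
          ENNReal.ofReal_natCast]
        simp only [Fintype.card_prod, Fintype.card_fin, Fintype.card_finset]
        rfl
    _ ≤ ENNReal.ofReal δ :=
        ENNReal.ofReal_le_ofReal (union_bound_transitions hX2 hA hK hH hδ hδ1)

end Transitions

/-! ### Accuracy of maximum likelihood, via the Hellinger distance. -/

section Emissions

set_option linter.unusedSectionVars false

variable {𝒳 𝒴 𝒜 : Type*} [Fintype 𝒳] [DecidableEq 𝒳] [MeasurableSpace 𝒳]
  [DiscreteMeasurableSpace 𝒳] [Fintype 𝒜] [DecidableEq 𝒜] [MeasurableSpace 𝒜]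
  [DiscreteMeasurableSpace 𝒜] [MeasurableSpace 𝒴] {ν : Measure 𝒴} {H k : ℕ}

/-- The Bhattacharyya coefficient of two densities. -/
def bhattacharyya (ν : Measure 𝒴) (p q : 𝒴 → ℝ≥0) : ℝ≥0∞ :=
  ∫⁻ y, (NNReal.sqrt (p y) * NNReal.sqrt (q y) : ℝ≥0) ∂ν

theorem bhattacharyya_le_one {p q : 𝒴 → ℝ≥0} (hp : Measurable p)
    (hp1 : ∫⁻ y, (p y : ℝ≥0∞) ∂ν = 1) (hq1 : ∫⁻ y, (q y : ℝ≥0∞) ∂ν = 1) :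
    bhattacharyya ν p q ≤ 1 := by
  have h : 2 * bhattacharyya ν p q ≤ 2 * 1 := by
    unfold bhattacharyya
    calc 2 * ∫⁻ y, ((NNReal.sqrt (p y) * NNReal.sqrt (q y) : ℝ≥0) : ℝ≥0∞) ∂ν
        = ∫⁻ y, 2 * ((NNReal.sqrt (p y) * NNReal.sqrt (q y) : ℝ≥0) : ℝ≥0∞) ∂ν :=
          (lintegral_const_mul' _ _ (by simp)).symm
      _ ≤ ∫⁻ y, ((p y : ℝ≥0∞) + q y) ∂ν := by
        refine lintegral_mono fun y => ?_
        have : 2 * (NNReal.sqrt (p y) * NNReal.sqrt (q y)) ≤ p y + q y := by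
          rw [← NNReal.coe_le_coe]
          push_cast
          have h1 := Real.sq_sqrt (p y).coe_nonneg
          have h2 := Real.sq_sqrt (q y).coe_nonneg
          nlinarith [sq_nonneg (√(p y : ℝ) - √(q y : ℝ))]
        simpa only [ENNReal.coe_mul, ENNReal.coe_add, ENNReal.coe_ofNat] using
          ENNReal.coe_le_coe.2 this
      _ = 2 * 1 := by
        rw [lintegral_add_left hp.coe_nnreal_ennreal, hp1, hq1]; norm_num
  exact (ENNReal.mul_le_mul_iff_right (by simp) (by simp)).1 h

theorem lintegral_tsub_le_one {p q : 𝒴 → ℝ≥0} (hp1 : ∫⁻ y, (p y : ℝ≥0∞) ∂ν = 1) :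
    ∫⁻ y, ((p y : ℝ≥0∞) - q y) ∂ν ≤ 1 :=
  (lintegral_mono fun _ => tsub_le_self).trans hp1.le

theorem lintegral_tsub_comm {p q : 𝒴 → ℝ≥0} (hp : Measurable p) (hq : Measurable q)
    (hp1 : ∫⁻ y, (p y : ℝ≥0∞) ∂ν = 1) (hq1 : ∫⁻ y, (q y : ℝ≥0∞) ∂ν = 1) :
    ∫⁻ y, ((p y : ℝ≥0∞) - q y) ∂ν = ∫⁻ y, ((q y : ℝ≥0∞) - p y) ∂ν := by
  have h : ∫⁻ y, (p y : ℝ≥0∞) ∂ν + ∫⁻ y, ((q y : ℝ≥0∞) - p y) ∂ν =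
      ∫⁻ y, (q y : ℝ≥0∞) ∂ν + ∫⁻ y, ((p y : ℝ≥0∞) - q y) ∂ν := by
    rw [← lintegral_add_left hp.coe_nnreal_ennreal, ← lintegral_add_left hq.coe_nnreal_ennreal]
    exact lintegral_congr fun y => by rw [add_tsub_eq_max, add_tsub_eq_max, max_comm]
  rw [hp1, hq1] at h
  exact ((ENNReal.add_right_inj ENNReal.one_ne_top).1 h).symm

/-- With `u = √a` and `v = √b`, this is Young's inequality for `u ^ 2 - v ^ 2 = (u - v) * (u + v)`,
with the negative cross term moved to the left. Integrated and optimized over `s`, it replaces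
Cauchy–Schwarz. -/
theorem tsub_sqrt_pointwise (a b : ℝ≥0) {s : ℝ} (hs : 0 < s) :
    ((a - b : ℝ≥0) : ℝ) + (√(a : ℝ) * √(b : ℝ)) / s ≤
      (1 / (2 * s) + s / 2) * (a + b) + s * (√(a : ℝ) * √(b : ℝ)) := by
  have h1 := Real.sq_sqrt a.coe_nonneg
  have h2 := Real.sq_sqrt b.coe_nonneg
  set u := √(a : ℝ)
  set v := √(b : ℝ)
  have key : (u ^ 2 - v ^ 2) ≤ (u - v) ^ 2 / (2 * s) + s / 2 * (u + v) ^ 2 := by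
    rw [← sub_nonneg]
    have : (u - v) ^ 2 / (2 * s) + s / 2 * (u + v) ^ 2 - (u ^ 2 - v ^ 2) =
        ((u - v) - s * (u + v)) ^ 2 / (2 * s) := by field_simp; ring
    rw [this]; positivity
  have hn : 0 ≤ (u - v) ^ 2 / (2 * s) + s / 2 * (u + v) ^ 2 := by positivity
  have hab : ((a - b : ℝ≥0) : ℝ) ≤ (u - v) ^ 2 / (2 * s) + s / 2 * (u + v) ^ 2 := by
    rw [NNReal.coe_sub_def]
    refine max_le ?_ hn
    rw [← h1, ← h2]; exact key
  rw [← h1, ← h2]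
  have : (1 / (2 * s) + s / 2) * (u ^ 2 + v ^ 2) + s * (u * v) =
      (u - v) ^ 2 / (2 * s) + s / 2 * (u + v) ^ 2 + u * v / s := by field_simp; ring
  linarith

/-- The total variation distance is bounded by the Hellinger distance. -/
theorem sq_lintegral_tsub_le {p q : 𝒴 → ℝ≥0} (hp : Measurable p) (hq : Measurable q)
    (hp1 : ∫⁻ y, (p y : ℝ≥0∞) ∂ν = 1) (hq1 : ∫⁻ y, (q y : ℝ≥0∞) ∂ν = 1) :
    (∫⁻ y, ((p y : ℝ≥0∞) - q y) ∂ν).toReal ^ 2 ≤ 8 * (1 - (bhattacharyya ν p q).toReal) := by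
  have hbc := bhattacharyya_le_one hp hp1 hq1
  have hbt : bhattacharyya ν p q ≠ ⊤ := ne_top_of_le_ne_top ENNReal.one_ne_top hbc
  have hdt : ∫⁻ y, ((p y : ℝ≥0∞) - q y) ∂ν ≠ ⊤ :=
    ne_top_of_le_ne_top ENNReal.one_ne_top (lintegral_tsub_le_one hp1)
  have hb1 : (bhattacharyya ν p q).toReal ≤ 1 := by
    simpa using ENNReal.toReal_mono ENNReal.one_ne_top hbc
  set d := (∫⁻ y, ((p y : ℝ≥0∞) - q y) ∂ν).toReal with hd
  set b := (bhattacharyya ν p q).toReal with hb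
  have hd0 : 0 ≤ d := ENNReal.toReal_nonneg
  rcases hd0.eq_or_lt with h0 | hpos
  · rw [← h0]; nlinarith
  -- The integrated inequality reads `d * s ≤ (1 - b) + s ^ 2 * (1 + b)`. As `b ≤ 1`, the choice `d
  -- = 4 * s` leaves `2 * s ^ 2 ≤ 1 - b`, that is `d ^ 2 ≤ 8 * (1 - b)`.
  set s := d / 4 with hs
  have hs0 : 0 < s := by positivity
  have hm : Measurable fun y => (NNReal.sqrt (p y) * NNReal.sqrt (q y)) := by fun_prop
  have key : ENNReal.ofReal d + ENNReal.ofReal (1 / s) * ENNReal.ofReal b ≤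
      ENNReal.ofReal (1 / (2 * s) + s / 2) * (∫⁻ y, (p y : ℝ≥0∞) ∂ν + ∫⁻ y, (q y : ℝ≥0∞) ∂ν) +
        ENNReal.ofReal s * ENNReal.ofReal b := by
    rw [hd, hb, ENNReal.ofReal_toReal hdt, ENNReal.ofReal_toReal hbt]
    unfold bhattacharyya
    rw [← lintegral_add_left hp.coe_nnreal_ennreal,
      ← lintegral_const_mul _ hm.coe_nnreal_ennreal,
      ← lintegral_const_mul _ hm.coe_nnreal_ennreal,
      ← lintegral_const_mul _ (hp.coe_nnreal_ennreal.fun_add hq.coe_nnreal_ennreal),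
      ← lintegral_add_left (hp.coe_nnreal_ennreal.fun_sub hq.coe_nnreal_ennreal),
      ← lintegral_add_left
        ((hp.coe_nnreal_ennreal.fun_add hq.coe_nnreal_ennreal).const_mul _)]
    refine lintegral_mono fun y => ?_
    have := tsub_sqrt_pointwise (p y) (q y) hs0
    have h1 : 0 ≤ 1 / s := by positivity
    have h2 : 0 ≤ 1 / (2 * s) + s / 2 := by positivity
    rw [← ENNReal.coe_sub]
    simp only [← ENNReal.ofReal_coe_nnreal]
    rw [← ENNReal.ofReal_mul h1, ← ENNReal.ofReal_add (by positivity) (by positivity),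
      ← ENNReal.ofReal_add (by positivity) (by positivity), ← ENNReal.ofReal_mul h2,
      ← ENNReal.ofReal_mul (by positivity), ← ENNReal.ofReal_add (by positivity) (by positivity)]
    refine ENNReal.ofReal_le_ofReal ?_
    push_cast
    rw [one_div_mul_eq_div]
    exact this
  have hb0 : 0 ≤ b := ENNReal.toReal_nonneg
  rw [hp1, hq1, one_add_one_eq_two, show (2 : ℝ≥0∞) = ENNReal.ofReal 2 by simp,
    ← ENNReal.ofReal_mul (by positivity), ← ENNReal.ofReal_mul (by positivity),
    ← ENNReal.ofReal_mul (by positivity), ← ENNReal.ofReal_add (by positivity) (by positivity),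
    ← ENNReal.ofReal_add (by positivity) (by positivity),
    ENNReal.ofReal_le_ofReal_iff (by positivity)] at key
  have h3 : d * s ≤ (1 - b) + s ^ 2 * (1 + b) := by
    have := mul_le_mul_of_nonneg_right key hs0.le
    have e1 : (d + 1 / s * b) * s = d * s + b := by field_simp
    have e2 : ((1 / (2 * s) + s / 2) * 2 + s * b) * s = 1 + s ^ 2 + s ^ 2 * b := by
      field_simp
    rw [e1, e2] at this
    linarith
  have h4 : d = 4 * s := by rw [hs]; ring
  nlinarith [mul_le_mul_of_nonneg_left hb1 (sq_nonneg s)]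

theorem ENNReal_log_prod {ι : Type*} (s : Finset ι) (f : ι → ℝ≥0∞) :
    ENNReal.log (∏ i ∈ s, f i) = ∑ i ∈ s, ENNReal.log (f i) := by
  classical
  induction s using Finset.induction_on with
  | empty => simp
  | insert i s hi ih => rw [Finset.prod_insert hi, Finset.sum_insert hi, ENNReal.log_mul_add, ih]

theorem logLik_eq_log (O : Emission 𝒳 ν) (D : Fin k → Traj 𝒳 𝒴 𝒜 H) :
    logLik O D = ENNReal.log
      ((∏ l, ∏ h : Fin H, O.density ((D l).1 h.castSucc) ((D l).2.1 h) : ℝ≥0) : ℝ≥0∞) := by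
  unfold logLik
  push_cast
  simp_rw [ENNReal_log_prod]

/-- The tilted emission weights interpolating between two emission functions. -/
def hellingerTilt (O O' : Emission 𝒳 ν) (x : 𝒳) (y : 𝒴) : ℝ≥0∞ :=
  ((NNReal.sqrt (O.density x y) * NNReal.sqrt (O'.density x y) : ℝ≥0) : ℝ≥0∞) *
    ENNReal.ofReal (Real.exp (1 - (bhattacharyya ν (O.density x) (O'.density x)).toReal))

theorem measurable_hellingerTilt (O O' : Emission 𝒳 ν) (x : 𝒳) :
    Measurable (hellingerTilt O O' x) := by
  have h1 := O.measurable_density x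
  have h2 := O'.measurable_density x
  have hm : Measurable fun y => NNReal.sqrt (O.density x y) * NNReal.sqrt (O'.density x y) := by
    fun_prop
  exact hm.coe_nnreal_ennreal.mul_const _

/-- The mass is `b * exp (1 - b)` for the Bhattacharyya coefficient `b`, and `b ≤ exp (b - 1)`. -/
theorem lintegral_hellingerTilt_le (O O' : Emission 𝒳 ν) (x : 𝒳) :
    ∫⁻ y, hellingerTilt O O' x y ∂ν ≤ 1 := by
  have hbt : bhattacharyya ν (O.density x) (O'.density x) ≠ ⊤ :=
    ne_top_of_le_ne_top ENNReal.one_ne_top (bhattacharyya_le_one (O.measurable_density x)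
      (O.lintegral_density x) (O'.lintegral_density x))
  unfold hellingerTilt
  rw [lintegral_mul_const' _ _ ENNReal.ofReal_ne_top]
  show bhattacharyya ν (O.density x) (O'.density x) * _ ≤ 1
  set b := (bhattacharyya ν (O.density x) (O'.density x)).toReal with hb
  rw [← ENNReal.ofReal_toReal hbt, ← hb, ← ENNReal.ofReal_mul ENNReal.toReal_nonneg,
    ENNReal.ofReal_le_one]
  have := Real.add_one_le_exp (b - 1)
  calc b * Real.exp (1 - b) ≤ Real.exp (b - 1) * Real.exp (1 - b) := by gcongr; linarith
    _ = 1 := by rw [← Real.exp_add]; simp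

theorem trajWeight_eq_prod_emission (ρ : PMF 𝒳) (T : 𝒳 → 𝒜 → 𝒳 → ℝ≥0∞) (π : Policy 𝒴 𝒜 H)
    (τ : Traj 𝒳 𝒴 𝒜 H) (E : 𝒳 → 𝒴 → ℝ≥0∞) :
    trajWeight ρ E T π τ = trajWeight ρ (fun _ _ => 1) T π τ *
      ∏ h : Fin H, E (τ.1 h.castSucc) (τ.2.1 h) := by
  unfold trajWeight
  rw [mul_assoc, ← Finset.prod_mul_distrib]
  congr 1
  exact Finset.prod_congr rfl fun h _ => by ring

/-- Dropping the visits to other states lets one likelihood event control all states at once, with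
no union over them. -/
theorem countX_mul_le_sum (D : Fin k → Traj 𝒳 𝒴 𝒜 H) (x : 𝒳) {f : 𝒳 → ℝ} (hf : ∀ z, 0 ≤ f z) :
    countX D x * f x ≤ ∑ l, ∑ h : Fin H, f ((D l).1 h.castSucc) := by
  unfold countX
  push_cast
  simp_rw [Finset.sum_mul]
  refine Finset.sum_le_sum fun l _ => Finset.sum_le_sum fun h _ => ?_
  split_ifs with hx
  · rw [hx, one_mul]
  · rw [zero_mul]; exact hf _

/-- Data for which a competing emission function has at least the likelihood of the true one,
although the two are far apart on the visited states, are unlikely. -/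
theorem dataLaw_likelihood_le [SigmaFinite ν] (M : POMDP 𝒳 𝒜 ν) {L : Learner 𝒳 𝒴 𝒜 H}
    (hL : L.IsSimple) {K : ℕ} (k : Fin K) (O : Emission 𝒳 ν) (t : ℝ) :
    dataLaw M L K {D | logLik M.emit (past D k) ≤ logLik O (past D k) ∧
      ∃ x, t ≤ countX (past D k) x *
        (1 - (bhattacharyya ν (O.density x) (M.emit.density x)).toReal)} ≤
      ENNReal.ofReal (Real.exp (-t)) := by
  refine dataLaw_le_of_past_le M hL k (measurable_hellingerTilt O M.emit)
    (lintegral_hellingerTilt_le O M.emit) (T := fun z c z' => M.trans z c z')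
    (fun _ _ => (sum_pmf _).le) _ fun D hD π => ?_
  obtain ⟨hlik, x, hx⟩ := hD
  rw [logLik_eq_log, logLik_eq_log, ENNReal.log_le_log_iff, ENNReal.coe_le_coe] at hlik
  simp_rw [trajDensity_eq_trajWeight,
    trajWeight_eq_prod_emission M.init (fun z c z' => M.trans z c z') _ _
      (fun x y => (M.emit.density x y : ℝ≥0∞)),
    trajWeight_eq_prod_emission M.init (fun z c z' => M.trans z c z') _ _
      (hellingerTilt O M.emit)]
  -- Initial law, policies and transitions are common factors of both densities; only emissions
  -- remain to be compared.
  rw [Finset.prod_mul_distrib, Finset.prod_mul_distrib, mul_left_comm]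
  refine mul_le_mul' le_rfl ?_
  generalize past D k = D' at hlik hx ⊢
  set f : 𝒳 → ℝ := fun x => 1 - (bhattacharyya ν (O.density x) (M.emit.density x)).toReal with hf
  have hf0 : ∀ z, 0 ≤ f z := fun z => sub_nonneg.2 <| by
    simpa using ENNReal.toReal_mono ENNReal.one_ne_top (bhattacharyya_le_one
      (O.measurable_density z) (O.lintegral_density z) (M.emit.lintegral_density z))
  have htilt : ∏ l, ∏ h : Fin H, hellingerTilt O M.emit ((D' l).1 h.castSucc) ((D' l).2.1 h) =
      ((∏ l, ∏ h : Fin H, NNReal.sqrt (O.density ((D' l).1 h.castSucc) ((D' l).2.1 h)) *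
        NNReal.sqrt (M.emit.density ((D' l).1 h.castSucc) ((D' l).2.1 h)) : ℝ≥0) : ℝ≥0∞) *
        ENNReal.ofReal (Real.exp (∑ l, ∑ h : Fin H, f ((D' l).1 h.castSucc))) := by
    unfold hellingerTilt
    simp_rw [Finset.prod_mul_distrib,
      ← ENNReal.ofReal_prod_of_nonneg fun _ _ => (Real.exp_pos _).le, ← Real.exp_sum]
    rw [← ENNReal.ofReal_prod_of_nonneg fun _ _ => (Real.exp_pos _).le, ← Real.exp_sum]
    congr 1
    push_cast
    simp_rw [Finset.prod_mul_distrib]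
  have hsum : t ≤ ∑ l, ∑ h : Fin H, f ((D' l).1 h.castSucc) :=
    hx.trans (countX_mul_le_sum D' x hf0)
  rw [htilt, mul_left_comm, ← ENNReal.ofReal_mul (Real.exp_pos _).le, ← Real.exp_add]
  have hcoe : ∏ l, ∏ h : Fin H, (M.emit.density ((D' l).1 h.castSucc) ((D' l).2.1 h) : ℝ≥0∞) =
      ((∏ l, ∏ h : Fin H, M.emit.density ((D' l).1 h.castSucc) ((D' l).2.1 h) : ℝ≥0) : ℝ≥0∞) := by
    push_cast; rfl
  rw [hcoe]
  refine le_trans (ENNReal.coe_le_coe.2 ?_) (le_mul_of_one_le_right' ?_)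
  · simp_rw [Finset.prod_mul_distrib]
    set u := ∏ l, ∏ h : Fin H, NNReal.sqrt (M.emit.density ((D' l).1 h.castSucc) ((D' l).2.1 h))
      with hu
    set v := ∏ l, ∏ h : Fin H, NNReal.sqrt (O.density ((D' l).1 h.castSucc) ((D' l).2.1 h))
      with hv
    have huu : ∏ l, ∏ h : Fin H, M.emit.density ((D' l).1 h.castSucc) ((D' l).2.1 h) = u * u := by
      rw [hu]; simp_rw [← Finset.prod_mul_distrib, NNReal.mul_self_sqrt]
    have hvv : ∏ l, ∏ h : Fin H, O.density ((D' l).1 h.castSucc) ((D' l).2.1 h) = v * v := by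
      rw [hv]; simp_rw [← Finset.prod_mul_distrib, NNReal.mul_self_sqrt]
    rw [huu, hvv] at hlik
    -- A competitor at least as likely as the truth has likelihood `v * v ≥ u * u`, so the true
    -- likelihood is at most the geometric mean `u * v` found in the tilt.
    have huv : u ≤ v := by
      by_contra h
      exact absurd hlik (not_le.2 (mul_self_lt_mul_self zero_le (not_le.1 h)))
    rw [huu]
    exact mul_le_mul_left huv u
  · rw [ENNReal.one_le_ofReal, Real.one_le_exp_iff]
    linarith

/-- With high probability the maximum likelihood estimates stay within the emission bonus. -/
theorem dataLaw_mle_bad_le [SigmaFinite ν] (M : POMDP 𝒳 𝒜 ν) {L : Learner 𝒳 𝒴 𝒜 H}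
    (hL : L.IsSimple) {K : ℕ} {δ : ℝ} (hK : 1 ≤ K) (hδ : 0 < δ) (hδ1 : δ < 1)
    {Θ : Finset (Emission 𝒳 ν)} (hM : M.emit ∈ Θ)
    {mle : (k : ℕ) → (Fin k → Traj 𝒳 𝒴 𝒜 H) → Emission 𝒳 ν}
    (hmle : ∀ k, 1 ≤ k → ∀ D, IsMLE Θ D (mle k D)) :
    dataLaw M L K {D | ∃ k : Fin K, 1 ≤ (k : ℕ) ∧ ∃ x,
      ENNReal.ofReal (bonusX Θ.card K δ (past D k) x) <
        ∫⁻ y, (((mle k (past D k)).density x y : ℝ≥0∞) - M.emit.density x y) ∂ν} ≤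
      ENNReal.ofReal δ := by
  have hX1 : 1 ≤ Fintype.card 𝒳 :=
    Fintype.card_pos_iff.2 ⟨M.init.support_nonempty.some⟩
  have hN1 : 1 ≤ Θ.card := Finset.card_pos.2 ⟨_, hM⟩
  set X := Fintype.card 𝒳
  set N := Θ.card with hN
  have hX' : (1 : ℝ) ≤ X := by exact_mod_cast hX1
  have hN' : (1 : ℝ) ≤ N := by exact_mod_cast hN1
  have hK' : (1 : ℝ) ≤ K := by exact_mod_cast hK
  set Z := (N : ℝ) * X * K / δ with hZ
  have hZ1 : 1 < Z := by
    rw [hZ, lt_div_iff₀ hδ, one_mul]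
    refine hδ1.trans_le ?_
    calc (1 : ℝ) = 1 * 1 * 1 := by norm_num
      _ ≤ _ := by gcongr
  have hlog : 0 < Real.log Z := Real.log_pos hZ1
  set β := 8 * Real.log Z with hβ
  let B : Fin K × Θ → Set (Fin K → Traj 𝒳 𝒴 𝒜 H) := fun i =>
    {D | logLik M.emit (past D i.1) ≤ logLik i.2.1 (past D i.1) ∧
      ∃ x, Real.log Z ≤ countX (past D i.1) x *
        (1 - (bhattacharyya ν (i.2.1.density x) (M.emit.density x)).toReal)}
  have hB : ∀ i, dataLaw M L K (B i) ≤ ENNReal.ofReal (Real.exp (-Real.log Z)) :=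
    fun i => dataLaw_likelihood_le M hL i.1 i.2.1 _
  have hsub : {D | ∃ k : Fin K, 1 ≤ (k : ℕ) ∧ ∃ x,
      ENNReal.ofReal (bonusX Θ.card K δ (past D k) x) <
        ∫⁻ y, (((mle k (past D k)).density x y : ℝ≥0∞) - M.emit.density x y) ∂ν} ⊆ ⋃ i, B i := by
    rintro D ⟨k, hk, x, hbad⟩
    obtain ⟨hmem, hmax⟩ := hmle k hk (past D k)
    set O := mle k (past D k)
    refine Set.mem_iUnion.2 ⟨(k, ⟨O, hmem⟩), hmax _ hM, x, ?_⟩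
    show Real.log Z ≤ countX (past D k) x *
      (1 - (bhattacharyya ν (O.density x) (M.emit.density x)).toReal)
    have hle1 := lintegral_tsub_le_one (q := M.emit.density x) (O.lintegral_density x)
    have hsq := sq_lintegral_tsub_le (O.measurable_density x) (M.emit.measurable_density x)
      (O.lintegral_density x) (M.emit.lintegral_density x)
    set d := ∫⁻ y, ((O.density x y : ℝ≥0∞) - M.emit.density x y) ∂ν
    set n := countX (past D k) x with hn
    have hb1 : bonusX N K δ (past D k) x < 1 := by
      have := hbad.trans_le hle1
      rwa [← ENNReal.ofReal_one, ENNReal.ofReal_lt_ofReal_iff one_pos] at this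
    have hn0 : n ≠ 0 := by
      intro h0
      simp only [bonusX, bonus, ← hn, h0, if_true] at hb1
      norm_num at hb1
    have hnpos : (0 : ℝ) < n := by exact_mod_cast Nat.pos_of_ne_zero hn0
    have hbeq : bonusX N K δ (past D k) x = Real.sqrt (β / n) := by
      simp only [bonusX, bonus, ← hn, hn0, if_false] at hb1 ⊢
      rcases min_choice 2 (Real.sqrt (β / n)) with h | h
      · rw [h] at hb1; norm_num at hb1
      · exact h
    rw [hbeq, ENNReal.ofReal_lt_iff_lt_toReal (Real.sqrt_nonneg _)
      (ne_top_of_le_ne_top ENNReal.one_ne_top hle1)] at hbad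
    have h2 : β / n < d.toReal ^ 2 := by
      rw [← Real.sq_sqrt (show 0 ≤ β / n by positivity)]
      gcongr
    rw [div_lt_iff₀' hnpos] at h2
    nlinarith [mul_le_mul_of_nonneg_left hsq hnpos.le]
  calc _ ≤ dataLaw M L K (⋃ i, B i) := measure_mono hsub
    _ ≤ ∑ i, dataLaw M L K (B i) := measure_iUnion_fintype_le _ _
    _ ≤ ∑ _i : Fin K × Θ, ENNReal.ofReal (Real.exp (-Real.log Z)) :=
        Finset.sum_le_sum fun i _ => hB i
    _ = ENNReal.ofReal (((K * N : ℕ) : ℝ) * Real.exp (-Real.log Z)) := by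
        rw [Finset.sum_const, Finset.card_univ, nsmul_eq_mul, ENNReal.ofReal_mul (by positivity),
          ENNReal.ofReal_natCast]
        simp only [Fintype.card_prod, Fintype.card_fin, Fintype.card_coe]
        rfl
    _ ≤ ENNReal.ofReal δ := by
        refine ENNReal.ofReal_le_ofReal ?_
        rw [Real.exp_neg, Real.exp_log (by linarith), hZ, inv_div]
        push_cast
        rw [mul_div_assoc', div_le_iff₀ (by positivity)]
        nlinarith [mul_pos (mul_pos hδ (by linarith : (0 : ℝ) < N)) (by linarith : (0 : ℝ) < K)]

end Emissions

/-! ### Regularity of the algorithm and the regret of one round. -/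

section Regularity

set_option linter.unusedSectionVars false

variable {𝒳 𝒴 𝒜 : Type*} [Fintype 𝒳] [DecidableEq 𝒳] [MeasurableSpace 𝒳]
  [DiscreteMeasurableSpace 𝒳] [Fintype 𝒜] [DecidableEq 𝒜] [MeasurableSpace 𝒜]
  [DiscreteMeasurableSpace 𝒜] [MeasurableSpace 𝒴] {ν : Measure 𝒴} {H k : ℕ}

theorem fst_eq_of_skeleton_eq {D D' : Fin k → Traj 𝒳 𝒴 𝒜 H} (h : skeleton D = skeleton D')
    (l : Fin k) : (D l).1 = (D' l).1 := by
  have := congrFun h l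
  exact (Prod.ext_iff.1 this).1

theorem snd_eq_of_skeleton_eq {D D' : Fin k → Traj 𝒳 𝒴 𝒜 H} (h : skeleton D = skeleton D')
    (l : Fin k) : (D l).2.2 = (D' l).2.2 := by
  have := congrFun h l
  exact (Prod.ext_iff.1 this).2

theorem countX_congr {D D' : Fin k → Traj 𝒳 𝒴 𝒜 H} (h : skeleton D = skeleton D') :
    countX D = countX D' := by
  funext x
  simp only [countX, fst_eq_of_skeleton_eq h]

theorem countXA_congr {D D' : Fin k → Traj 𝒳 𝒴 𝒜 H} (h : skeleton D = skeleton D') :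
    countXA D = countXA D' := by
  funext x a
  simp only [countXA, fst_eq_of_skeleton_eq h, snd_eq_of_skeleton_eq h]

theorem countXAX_congr {D D' : Fin k → Traj 𝒳 𝒴 𝒜 H} (h : skeleton D = skeleton D') :
    countXAX D = countXAX D' := by
  funext x a x'
  simp only [countXAX, fst_eq_of_skeleton_eq h, snd_eq_of_skeleton_eq h]

theorem transEst_congr (T₁ : 𝒳 → 𝒜 → PMF 𝒳) {D D' : Fin k → Traj 𝒳 𝒴 𝒜 H}
    (h : skeleton D = skeleton D') : transEst T₁ D = transEst T₁ D' := by
  funext x a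
  ext x'
  rw [transEst_apply, transEst_apply, countXA_congr h, countXAX_congr h]

/-- Counts, hence estimated transitions and rewards, depend only on the finite skeleton, and after
the first round the emission estimate ranges over the finite class. The planner thus sees finitely
many inputs and needs no measurability. -/
theorem hopB_isSimple (r : 𝒳 → 𝒜 → ℝ) (N K : ℕ) (δ : ℝ) (T₁ : 𝒳 → 𝒜 → PMF 𝒳)
    (O₁ : Emission 𝒳 ν)
    (POP : (𝒳 → 𝒜 → PMF 𝒳) → Emission 𝒳 ν → (𝒳 → 𝒜 → ℝ) → Policy 𝒴 𝒜 H)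
    {Θ : Finset (Emission 𝒳 ν)} {mle : (k : ℕ) → (Fin k → Traj 𝒳 𝒴 𝒜 H) → Emission 𝒳 ν}
    (hmle : ∀ k, 1 ≤ k → ∀ D, IsMLE Θ D (mle k D))
    (hmeas : ∀ k, 1 ≤ k → ∀ O ∈ Θ, MeasurableSet {D | mle k D = O}) :
    (hopB r N K δ T₁ O₁ POP mle).IsSimple := by
  intro k
  rcases Nat.eq_zero_or_pos k with rfl | hk
  · exact ⟨1, fun _ => 0, measurable_const, fun D D' _ => by rw [Subsingleton.elim D D']⟩
  · let ι := (Fin k → (Fin (H + 1) → 𝒳) × (Fin H → 𝒜)) × Θ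
    let e : ι ≃ Fin (Fintype.card ι) := Fintype.equivFin ι
    let q : (Fin k → Traj 𝒳 𝒴 𝒜 H) → ι := fun D => (skeleton D, ⟨mle k D, (hmle k hk D).1⟩)
    refine ⟨Fintype.card ι, fun D => e (q D), ?_, fun D D' hD => ?_⟩
    · refine measurable_to_countable' fun i => ?_
      have : (fun D => e (q D)) ⁻¹' {i} =
          (skeleton ⁻¹' {(e.symm i).1}) ∩ {D | mle k D = (e.symm i).2} := by
        ext D
        simp only [Set.mem_preimage, Set.mem_singleton_iff, Set.mem_inter_iff, Set.mem_ofPred_eq]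
        rw [← Equiv.eq_symm_apply, Prod.ext_iff, Subtype.ext_iff]
      rw [this]
      exact (measurable_skeleton (measurableSet_singleton _)).inter
        (hmeas k hk _ (e.symm i).2.2)
    · have hq : q D = q D' := e.injective hD
      have hs : skeleton D = skeleton D' := congrArg Prod.fst hq
      have hm : mle k D = mle k D' := congrArg (fun z : ι => (z.2 : Emission 𝒳 ν)) hq
      have hr : optReward r N K δ D = optReward r N K δ D' := by
        funext x a
        simp only [optReward, bonusXA, bonusX, countXA_congr hs, countX_congr hs]
      simp only [hopB, transEst_congr T₁ hs, hm, hr]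

/-- The total one-step bonus. -/
def totalBonus (N K : ℕ) (δ : ℝ) (D : Fin k → Traj 𝒳 𝒴 𝒜 H) (x : 𝒳) (a : 𝒜) : ℝ :=
  bonusX N K δ D x + bonusXA K δ D x a

theorem totalBonus_congr (N K : ℕ) (δ : ℝ) {D D' : Fin k → Traj 𝒳 𝒴 𝒜 H}
    (h : skeleton D = skeleton D') : totalBonus N K δ D = totalBonus N K δ D' := by
  funext x a
  simp only [totalBonus, bonusXA, bonusX, countXA_congr h, countX_congr h]

theorem totalBonus_nonneg (N K : ℕ) (δ : ℝ) (D : Fin k → Traj 𝒳 𝒴 𝒜 H) (x : 𝒳) (a : 𝒜) :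
    0 ≤ totalBonus N K δ D x a := add_nonneg (bonus_nonneg _ _) (bonus_nonneg _ _)

theorem totalBonus_le (N K : ℕ) (δ : ℝ) (D : Fin k → Traj 𝒳 𝒴 𝒜 H) (x : 𝒳) (a : 𝒜) :
    totalBonus N K δ D x a ≤ 4 :=
  (add_le_add (bonus_le_two _ _) (bonus_le_two _ _)).trans (by norm_num)

/-- Optimism followed by a second comparison. Of the constant `12`, `9` comes from optimistic
rewards of size at most `9 * H` in the simulation lemma, and `3` from the bonuses contained in the
optimistic reward. -/
theorem value_sub_le_totalBonus [SigmaFinite ν] (M : POMDP 𝒳 𝒜 ν) (πstar π : Policy 𝒴 𝒜 H)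
    (hH : 1 ≤ H) (hr : ∀ x a, M.reward x a ∈ Set.Icc (0 : ℝ) 1) (N K : ℕ) (δ : ℝ)
    (D : Fin k → Traj 𝒳 𝒴 𝒜 H) (T : 𝒳 → 𝒜 → PMF 𝒳) (O : Emission 𝒳 ν)
    (hT : ∀ x a, ∑ x', (T x a x' - M.trans x a x') ≤ ENNReal.ofReal (bonusXA K δ D x a))
    (hO : ∀ x, ∫⁻ y, ((O.density x y : ℝ≥0∞) - M.emit.density x y) ∂ν ≤
      ENNReal.ofReal (bonusX N K δ D x))
    (hπ : IsOptimal ⟨M.init, T, O, optReward M.reward N K δ D⟩ π) :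
    value M πstar - value M π ≤
      12 * H ^ 2 * value ⟨M.init, M.trans, M.emit, totalBonus N K δ D⟩ π := by
  have hH' : (1 : ℝ) ≤ H := by exact_mod_cast hH
  have hO0 : ∀ x, 0 ≤ bonusX N K δ D x := fun x => bonus_nonneg _ _
  have hT0 : ∀ x a, 0 ≤ bonusXA K δ D x a := fun x a => bonus_nonneg _ _
  -- The base is the estimated model, where the planner optimizes; one-sided discrepancies of
  -- probability laws are symmetric, so the hypotheses apply in reverse.
  have h1 := value_le_value_add_discrepancy M.init T M.trans O M.emit (r := M.reward) (b := 1)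
    (fun x a => (hr x a).1) (fun x a => (hr x a).2) zero_le_one hO0 hT0
    (fun x => (lintegral_tsub_comm (M.emit.measurable_density x) (O.measurable_density x)
      (M.emit.lintegral_density x) (O.lintegral_density x)).trans_le (hO x))
    (fun x a => (sum_tsub_comm _ _).trans_le (hT x a)) πstar
  rw [mul_one, ← value_const_mul, ← value_add] at h1
  have h2 : value ⟨M.init, T, O, fun x a => M.reward x a +
      H * (bonusX N K δ D x + bonusXA K δ D x a)⟩ πstar ≤
      value ⟨M.init, T, O, optReward M.reward N K δ D⟩ πstar := by
    refine value_mono _ _ _ (fun x a => ?_) _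
    unfold optReward
    nlinarith [mul_nonneg (by linarith : (0 : ℝ) ≤ H) (hT0 x a)]
  have h3 := hπ πstar
  have hopt0 : ∀ x a, 0 ≤ optReward M.reward N K δ D x a := fun x a => by
    have h1 := (hr x a).1
    have h2 := hT0 x a
    have h3 := hO0 x
    unfold optReward
    positivity
  have hopt9 : ∀ x a, optReward M.reward N K δ D x a ≤ 9 * H := fun x a => by
    have h1 := (hr x a).2
    have h2 : bonusXA K δ D x a ≤ 2 := bonus_le_two _ _
    have h3 : bonusX N K δ D x ≤ 2 := bonus_le_two _ _
    unfold optReward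
    nlinarith
  -- Here the base is the true model, so the error is a bonus expected along the real episode.
  have h4 := value_le_value_add_discrepancy M.init M.trans T M.emit O
    (r := optReward M.reward N K δ D) (b := 9 * H) hopt0 hopt9 (by positivity) hO0 hT0 hO hT π
  have h5 : value ⟨M.init, M.trans, M.emit, optReward M.reward N K δ D⟩ π ≤
      value M π + 3 * H * value ⟨M.init, M.trans, M.emit, totalBonus N K δ D⟩ π := by
    rw [← value_const_mul]
    refine le_of_le_of_eq (value_mono _ _ _ (fun x a => ?_) _)
      (value_add M.init M.trans M.emit M.reward _ π)
    unfold optReward totalBonus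
    nlinarith [mul_nonneg (by linarith : (0 : ℝ) ≤ H) (hO0 x)]
  have hv : 0 ≤ value ⟨M.init, M.trans, M.emit, totalBonus N K δ D⟩ π :=
    value_nonneg ⟨M.init, M.trans, M.emit, totalBonus N K δ D⟩
      (fun x a => totalBonus_nonneg N K δ D x a) π
  have h6 : (H : ℝ) * (9 * H) * value ⟨M.init, M.trans, M.emit,
      fun x a => bonusX N K δ D x + bonusXA K δ D x a⟩ π =
      9 * H ^ 2 * value ⟨M.init, M.trans, M.emit, totalBonus N K δ D⟩ π := by
    rw [show (H : ℝ) * (9 * H) = 9 * H ^ 2 by ring]; rfl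
  rw [h6] at h4
  have h7 : value M πstar ≤ value M π + 3 * H *
      value ⟨M.init, M.trans, M.emit, totalBonus N K δ D⟩ π +
      9 * H ^ 2 * value ⟨M.init, M.trans, M.emit, totalBonus N K δ D⟩ π :=
    h1.trans (h2.trans (h3.trans (h4.trans (by linarith))))
  have h8 : 3 * (H : ℝ) * value ⟨M.init, M.trans, M.emit, totalBonus N K δ D⟩ π ≤
      3 * H ^ 2 * value ⟨M.init, M.trans, M.emit, totalBonus N K δ D⟩ π := by
    gcongr
    exact le_self_pow₀ hH' two_ne_zero
  linarith

end Regularity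

/-! ### Summing the collected bonuses. -/

section Pigeonhole

/-- Counts are frozen during an episode, so they can lag by up to `H` visits. While the count is
below `H`, each visit is charged the maximal bonus `2`; at most `2 * H` visits are charged this way.
Afterwards an episode at most doubles the count, and `m / √n ≤ 3 * (√(n + m) - √n)` telescopes. -/
theorem sum_mul_bonus_le {H : ℕ} {β : ℝ} (hβ : 0 ≤ β) {K : ℕ} (v : Fin K → ℕ)
    (hv : ∀ k, v k ≤ H) :
    ∑ k : Fin K, (v k : ℝ) * bonus β (∑ l, past v k l) ≤
      2 * (min (∑ k, v k) (2 * H) : ℕ) + 3 * √β * √((∑ k, v k : ℕ) : ℝ) := by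
  induction K with
  | zero => simp
  | succ K ih =>
    rw [Fin.sum_univ_castSucc, Fin.sum_univ_castSucc v]
    have ih' := ih (fun k => v k.castSucc) fun k => hv _
    have hlast := hv (Fin.last K)
    set n := ∑ l : Fin K, v l.castSucc with hn
    set m := v (Fin.last K)
    refine le_trans (add_le_add ih' (le_refl ((m : ℝ) * bonus β n))) ?_
    have hsb := Real.sqrt_nonneg β
    have hmono : √(n : ℝ) ≤ √((n + m : ℕ) : ℝ) :=
      Real.sqrt_le_sqrt (by exact_mod_cast Nat.le_add_right n m)
    by_cases hnH : n < H
    · have h1 : min n (2 * H) = n := by omega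
      have h2 : min (n + m) (2 * H) = n + m := by omega
      rw [h1, h2]
      have h3 : (m : ℝ) * bonus β n ≤ m * 2 :=
        mul_le_mul_of_nonneg_left (bonus_le_two β n) m.cast_nonneg
      have h4 := mul_le_mul_of_nonneg_left hmono (by positivity : 0 ≤ 3 * √β)
      push_cast at *
      linarith
    · have hmn : m ≤ n := hlast.trans (not_lt.1 hnH)
      have h1 : (2 : ℝ) * (min n (2 * H) : ℕ) ≤ 2 * (min (n + m) (2 * H) : ℕ) := by
        have : min n (2 * H) ≤ min (n + m) (2 * H) := min_le_min_right _ (Nat.le_add_right _ _)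
        gcongr
      have h2 : (m : ℝ) * bonus β n ≤ 3 * √β * (√((n + m : ℕ) : ℝ) - √(n : ℝ)) := by
        rcases Nat.eq_zero_or_pos n with h0 | hpos
        · have hm0 : m = 0 := by omega
          rw [hm0, h0]; simp
        · have hs : 0 < √(n : ℝ) := Real.sqrt_pos.2 (by exact_mod_cast hpos)
          have hb : bonus β n ≤ √β / √(n : ℝ) := by
            unfold bonus
            rw [if_neg hpos.ne', ← Real.sqrt_div hβ]
            exact min_le_right _ _
          have hs2 := Real.sq_sqrt (n.cast_nonneg (α := ℝ))
          have ht2 := Real.sq_sqrt ((n + m).cast_nonneg (α := ℝ))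
          set s := √(n : ℝ)
          set t := √((n + m : ℕ) : ℝ)
          have ht : t ≤ 2 * s := by
            refine abs_le_of_sq_le_sq' ?_ (by positivity) |>.2
            have : (m : ℝ) ≤ n := by exact_mod_cast hmn
            push_cast at ht2
            nlinarith
          have hm : (m : ℝ) = (t - s) * (t + s) := by
            push_cast at ht2
            linear_combination hs2 - ht2
          calc (m : ℝ) * bonus β n ≤ m * (√β / s) := by gcongr
            _ = √β * ((t - s) * ((t + s) / s)) := by rw [hm]; ring
            _ ≤ √β * ((t - s) * 3) := by
              have : (t + s) / s ≤ 3 := by rw [div_le_iff₀ hs]; linarith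
              have hts : 0 ≤ t - s := by linarith
              gcongr
            _ = _ := by ring
      linarith

/-- Pigeonhole bound for the bonuses collected along `K` episodes of length `H`. -/
theorem sum_bonus_le {C : Type*} [Fintype C] [DecidableEq C] {H K : ℕ} {β : ℝ} (hβ : 0 ≤ β)
    (c : Fin K → Fin H → C) :
    ∑ k : Fin K, ∑ h : Fin H,
      bonus β (∑ l, ∑ h' : Fin H, if past c k l h' = c k h then 1 else 0) ≤
      4 * H * Fintype.card C + 3 * √(β * (Fintype.card C * K * H)) := by
  set v : C → Fin K → ℕ := fun z k => ∑ h : Fin H, if c k h = z then 1 else 0 with hv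
  have hvH : ∀ z k, v z k ≤ H := fun z k => by
    calc v z k ≤ ∑ h : Fin H, 1 := Finset.sum_le_sum fun h _ => by split_ifs <;> simp
      _ = H := by simp
  have htot : ∑ z, ∑ k, v z k = K * H := by
    rw [Finset.sum_comm]
    simp only [hv]
    simp_rw [Finset.sum_comm (s := (Finset.univ : Finset C))]
    simp
  -- Regroup the steps by the cell they visit.
  have h1 : ∑ k : Fin K, ∑ h : Fin H,
      bonus β (∑ l, ∑ h' : Fin H, if past c k l h' = c k h then 1 else 0) =
      ∑ z, ∑ k : Fin K, (v z k : ℝ) * bonus β (∑ l, past (v z) k l) := by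
    rw [Finset.sum_comm]
    nth_rewrite 2 [Finset.sum_comm]
    rw [Finset.sum_comm]
    refine Finset.sum_congr rfl fun k _ => ?_
    simp only [hv]
    push_cast
    simp_rw [Finset.sum_mul]
    rw [Finset.sum_comm]
    refine Finset.sum_congr rfl fun h _ => ?_
    simp only [ite_mul, one_mul, zero_mul, Finset.sum_ite_eq, Finset.mem_univ, if_true]
    rfl
  rw [h1]
  have h2 : ∀ z, ∑ k : Fin K, (v z k : ℝ) * bonus β (∑ l, past (v z) k l) ≤
      4 * H + 3 * √β * √((∑ k, v z k : ℕ) : ℝ) := fun z => by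
    refine (sum_mul_bonus_le hβ (v z) (hvH z)).trans ?_
    have : ((min (∑ k, v z k) (2 * H) : ℕ) : ℝ) ≤ 2 * H := by
      exact_mod_cast min_le_right _ _
    linarith
  refine (Finset.sum_le_sum fun z _ => h2 z).trans ?_
  rw [Finset.sum_add_distrib, ← Finset.mul_sum _ _ (3 * √β), Finset.sum_const, Finset.card_univ,
    nsmul_eq_mul, mul_comm (Fintype.card C : ℝ), Real.sqrt_mul hβ, ← mul_assoc 3]
  -- Cauchy–Schwarz over the cells, whose visits total `K * H`.
  have h3 : ∑ z, √((∑ k, v z k : ℕ) : ℝ) ≤ √(Fintype.card C * K * H) := by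
    refine Real.le_sqrt_of_sq_le ?_
    refine sq_sum_le_card_mul_sum_sq.trans ?_
    simp_rw [Real.sq_sqrt (Nat.cast_nonneg _)]
    rw [← Nat.cast_sum, htot, Finset.card_univ]
    push_cast
    exact le_of_eq (by ring)
  gcongr

end Pigeonhole

/-! ### Assembling the regret bound. -/

section Regret

set_option linter.unusedSectionVars false

variable {𝒳 𝒴 𝒜 : Type*} [Fintype 𝒳] [DecidableEq 𝒳] [MeasurableSpace 𝒳]
  [DiscreteMeasurableSpace 𝒳] [Fintype 𝒜] [DecidableEq 𝒜] [MeasurableSpace 𝒜]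
  [DiscreteMeasurableSpace 𝒜] [MeasurableSpace 𝒴] {ν : Measure 𝒴} {H K : ℕ}

theorem sum_pathReward_totalBonus_le (N : ℕ) (δ : ℝ)
    (hβX : 0 ≤ Real.log ((N : ℝ) * Fintype.card 𝒳 * K / δ))
    (hβXA : 0 ≤ Real.log ((Fintype.card 𝒳 : ℝ) ^ 2 * Fintype.card 𝒜 * K * H / δ))
    (D : Fin K → Traj 𝒳 𝒴 𝒜 H) :
    ∑ k : Fin K, pathReward (totalBonus N K δ (past D k)) (D k) ≤
      (4 * H * Fintype.card 𝒳 + 3 * √(8 * Real.log ((N : ℝ) * Fintype.card 𝒳 * K / δ) *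
        (Fintype.card 𝒳 * K * H))) +
      (4 * H * (Fintype.card 𝒳 * Fintype.card 𝒜) + 3 * √(8 * Fintype.card 𝒳 *
        Real.log ((Fintype.card 𝒳 : ℝ) ^ 2 * Fintype.card 𝒜 * K * H / δ) *
        (Fintype.card 𝒳 * Fintype.card 𝒜 * K * H))) := by
  have h1 := sum_bonus_le (β := 8 * Real.log ((N : ℝ) * Fintype.card 𝒳 * K / δ))
    (by positivity) fun (k : Fin K) (h : Fin H) => (D k).1 h.castSucc
  have h2 := sum_bonus_le (β := 8 * Fintype.card 𝒳 *
    Real.log ((Fintype.card 𝒳 : ℝ) ^ 2 * Fintype.card 𝒜 * K * H / δ))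
    (by positivity) fun (k : Fin K) (h : Fin H) => ((D k).1 h.castSucc, (D k).2.2 h)
  rw [Fintype.card_prod] at h2
  push_cast at h2
  refine le_trans (le_of_eq ?_) (add_le_add h1 h2)
  simp only [pathReward, totalBonus, Finset.sum_add_distrib]
  congr 1
  refine Finset.sum_congr rfl fun k _ => Finset.sum_congr rfl fun h _ => ?_
  simp only [past, Prod.mk.injEq]
  rfl

theorem regret_le_mul (M : POMDP 𝒳 𝒜 ν) [SigmaFinite ν] (L : Learner 𝒳 𝒴 𝒜 H)
    (πstar : Policy 𝒴 𝒜 H) (hr : ∀ x a, M.reward x a ∈ Set.Icc (0 : ℝ) 1)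
    (D : Fin K → Traj 𝒳 𝒴 𝒜 H) : regret M L πstar D ≤ K * H := by
  unfold regret
  calc _ ≤ ∑ _k : Fin K, (H : ℝ) := Finset.sum_le_sum fun k _ => by
        have h1 := value_le M (fun x a => (hr x a).2) πstar
        have h2 := value_nonneg M (fun x a => (hr x a).1) (L k (past D k))
        linarith
    _ = K * H := by simp

theorem combine_regret_bounds {R X A H K N δ : ℝ} (hX : 1 ≤ X) (hA : 1 ≤ A) (hH : 1 ≤ H)
    (hK : 1 ≤ K) (hN : 1 ≤ N) (hδ : 0 < δ) (hδ1 : δ < 1) (htriv : R ≤ K * H)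
    (hR : R ≤ 12 * H ^ 2 * (2 * ((4 * H * X + 3 * √(8 * Real.log (N * X * K / δ) * (X * K * H))) +
      (4 * H * (X * A) +
        3 * √(8 * X * Real.log (X ^ 2 * A * K * H / δ) * (X * A * K * H)))) +
      2 * (H * 4 * Real.log (1 / δ)))) :
    R ≤ 300 * (√(H ^ 5 * X * K * (Real.log N + Real.log (2 * X ^ 2 * A * K * H / δ))) +
      √(H ^ 5 * X ^ 2 * A * K * Real.log (2 * X ^ 2 * A * K * H / δ))) := by
  set ι := Real.log (2 * X ^ 2 * A * K * H / δ) with hι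
  have hW : 1 ≤ X ^ 2 * A * K * H := by
    calc (1 : ℝ) = 1 ^ 2 * 1 * 1 * 1 := by norm_num
      _ ≤ _ := by gcongr
  have h2 : 2 ≤ 2 * X ^ 2 * A * K * H / δ := by
    rw [le_div_iff₀ hδ]; nlinarith
  -- The factor `2` inside the logarithm keeps `ι` away from zero, so it can absorb constants.
  have hι2 : 1 / 2 ≤ ι := by
    calc (1 / 2 : ℝ) ≤ Real.log 2 := by linarith [Real.log_two_gt_d9]
      _ ≤ ι := Real.log_le_log (by norm_num) h2
  have hlogN : 0 ≤ Real.log N := Real.log_nonneg hN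
  have hl1 : Real.log (N * X * K / δ) ≤ Real.log N + ι := by
    rw [hι, ← Real.log_mul (by positivity) (by positivity)]
    refine Real.log_le_log (by positivity) ?_
    rw [← mul_div_assoc]
    gcongr ?_ / δ
    calc N * X * K = N * (1 * X ^ 1 * 1 * K * 1) := by ring
      _ ≤ N * (2 * X ^ 2 * A * K * H) := by gcongr <;> norm_num
  have hl2 : Real.log (X ^ 2 * A * K * H / δ) ≤ ι := by
    refine Real.log_le_log (by positivity) ?_
    gcongr ?_ / δ
    nlinarith
  have hl3 : Real.log (1 / δ) ≤ ι := by
    refine Real.log_le_log (by positivity) ?_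
    gcongr ?_ / δ
    nlinarith
  set P := H ^ 5 * X * K * (Real.log N + ι) with hP
  set Q := H ^ 5 * X ^ 2 * A * K * ι with hQ
  have hP0 : 0 ≤ P := by positivity
  have hQ0 : 0 ≤ Q := by positivity
  have hs1 : H ^ 2 * √(8 * Real.log (N * X * K / δ) * (X * K * H)) ≤ 3 * √P := by
    rw [← Real.sqrt_sq (show 0 ≤ H ^ 2 by positivity), ← Real.sqrt_mul (by positivity),
      ← Real.sqrt_sq (show (0 : ℝ) ≤ 3 by norm_num), ← Real.sqrt_mul (by positivity)]
    refine Real.sqrt_le_sqrt ?_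
    calc (H ^ 2) ^ 2 * (8 * Real.log (N * X * K / δ) * (X * K * H))
        ≤ (H ^ 2) ^ 2 * (8 * (Real.log N + ι) * (X * K * H)) := by gcongr
      _ = 8 * P := by rw [hP]; ring
      _ ≤ 3 ^ 2 * P := by gcongr; norm_num
  have hs2 : H ^ 2 * √(8 * X * Real.log (X ^ 2 * A * K * H / δ) * (X * A * K * H)) ≤ 3 * √Q := by
    rw [← Real.sqrt_sq (show 0 ≤ H ^ 2 by positivity), ← Real.sqrt_mul (by positivity),
      ← Real.sqrt_sq (show (0 : ℝ) ≤ 3 by norm_num), ← Real.sqrt_mul (by positivity)]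
    refine Real.sqrt_le_sqrt ?_
    calc (H ^ 2) ^ 2 * (8 * X * Real.log (X ^ 2 * A * K * H / δ) * (X * A * K * H))
        ≤ (H ^ 2) ^ 2 * (8 * X * ι * (X * A * K * H)) := by gcongr
      _ = 8 * Q := by rw [hQ]; ring
      _ ≤ 3 ^ 2 * Q := by gcongr; norm_num
  set b := 96 * H ^ 3 * (X + X * A + Real.log (1 / δ)) with hb
  have hl0 : 0 ≤ Real.log (1 / δ) := Real.log_nonneg (by rw [le_div_iff₀ hδ]; linarith)
  have hb0 : 0 ≤ b := by positivity
  -- The part `b`, of order `H ^ 3`, need not be below `√Q` for small `K`. The minimum with the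
  -- trivial bound is at most their geometric mean, which has the right order; `22 ^ 2 = 484` covers
  -- `96 * 5 = 480`.
  have hmin : min (K * H) b ≤ 22 * √Q := by
    have hXA : X ≤ X * A := le_mul_of_one_le_right (by linarith) hA
    have hXA1 : 1 ≤ X * A := hX.trans hXA
    have h5 : X + X * A + Real.log (1 / δ) ≤ 5 * (X * A) * ι := by
      have e1 : ι ≤ X * A * ι := le_mul_of_one_le_left (by linarith) hXA1
      have e2 : X * A * (1 / 2) ≤ X * A * ι := by gcongr
      linarith
    have hmul : min (K * H) b ^ 2 ≤ 22 ^ 2 * Q := by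
      calc min (K * H) b ^ 2 = min (K * H) b * min (K * H) b := sq _
        _ ≤ K * H * b := mul_le_mul (min_le_left _ _) (min_le_right _ _)
          (le_min (by positivity) hb0) (by positivity)
        _ ≤ K * H * (96 * H ^ 3 * (5 * (X * A) * ι)) := by rw [hb]; gcongr
        _ = 480 * (H ^ 4 * X ^ 1 * A * K * ι) := by ring
        _ ≤ 22 ^ 2 * (H ^ 5 * X ^ 2 * A * K * ι) := by gcongr <;> norm_num
    rw [← Real.sqrt_sq (show (0 : ℝ) ≤ 22 by norm_num), ← Real.sqrt_mul (by positivity)]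
    exact Real.le_sqrt_of_sq_le hmul
  have hS : R ≤ 72 * (H ^ 2 * √(8 * Real.log (N * X * K / δ) * (X * K * H))) +
      72 * (H ^ 2 * √(8 * X * Real.log (X ^ 2 * A * K * H / δ) * (X * A * K * H))) + b :=
    hR.trans (le_of_eq (by rw [hb]; ring))
  have hPs := Real.sqrt_nonneg P
  have hQs := Real.sqrt_nonneg Q
  have hT1 : 0 ≤ H ^ 2 * √(8 * Real.log (N * X * K / δ) * (X * K * H)) := by positivity
  have hT2 : 0 ≤ H ^ 2 * √(8 * X * Real.log (X ^ 2 * A * K * H / δ) * (X * A * K * H)) := by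
    positivity
  -- Each main term contributes `72 * 3 = 216`; together with `22` this stays below `300`.
  rcases min_choice (K * H) b with h | h <;> rw [h] at hmin <;> linarith

/-- The regret bound on the event on which all estimates are accurate. -/
theorem hopB_regret_le [SigmaFinite ν] (δ : ℝ) (M : POMDP 𝒳 𝒜 ν) (πstar : Policy 𝒴 𝒜 H)
    (N : ℕ) (T₁ : 𝒳 → 𝒜 → PMF 𝒳) (O₁ : Emission 𝒳 ν)
    (POP : (𝒳 → 𝒜 → PMF 𝒳) → Emission 𝒳 ν → (𝒳 → 𝒜 → ℝ) → Policy 𝒴 𝒜 H)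
    (mle : (k : ℕ) → (Fin k → Traj 𝒳 𝒴 𝒜 H) → Emission 𝒳 ν)
    (hN : 1 ≤ N) (hA : 1 ≤ Fintype.card 𝒜) (hH : 1 ≤ H) (hK : 1 ≤ K) (hδ : 0 < δ) (hδ1 : δ < 1)
    (hr : ∀ x a, M.reward x a ∈ Set.Icc (0 : ℝ) 1) (hPOP : IsPlanner M.init POP)
    (D : Fin K → Traj 𝒳 𝒴 𝒜 H)
    (hT : ∀ (k : Fin K) x a, ∑ x', (transEst T₁ (past D k) x a x' - M.trans x a x') ≤
      ENNReal.ofReal (bonusXA K δ (past D k) x a))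
    (hO : ∀ k : Fin K, 1 ≤ (k : ℕ) → ∀ x,
      ∫⁻ y, (((mle k (past D k)).density x y : ℝ≥0∞) - M.emit.density x y) ∂ν ≤
        ENNReal.ofReal (bonusX N K δ (past D k) x))
    (hV : ∑ k : Fin K, value ⟨M.init, M.trans, M.emit, totalBonus N K δ (past D k)⟩
        (hopB M.reward N K δ T₁ O₁ POP mle k (past D k)) ≤
      2 * ∑ k : Fin K, pathReward (totalBonus N K δ (past D k)) (D k) +
        2 * (H * 4 * Real.log (1 / δ))) :
    regret M (hopB M.reward N K δ T₁ O₁ POP mle) πstar D ≤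
      300 * (√((H : ℝ) ^ 5 * Fintype.card 𝒳 * K * (Real.log N +
          Real.log (2 * (Fintype.card 𝒳 : ℝ) ^ 2 * Fintype.card 𝒜 * K * H / δ))) +
        √((H : ℝ) ^ 5 * (Fintype.card 𝒳 : ℝ) ^ 2 * Fintype.card 𝒜 * K *
          Real.log (2 * (Fintype.card 𝒳 : ℝ) ^ 2 * Fintype.card 𝒜 * K * H / δ))) := by
  have hX : 1 ≤ Fintype.card 𝒳 := Fintype.card_pos_iff.2 ⟨M.init.support_nonempty.some⟩
  have hX' : (1 : ℝ) ≤ Fintype.card 𝒳 := by exact_mod_cast hX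
  have hA' : (1 : ℝ) ≤ Fintype.card 𝒜 := by exact_mod_cast hA
  have hK' : (1 : ℝ) ≤ K := by exact_mod_cast hK
  have hH' : (1 : ℝ) ≤ H := by exact_mod_cast hH
  have hN' : (1 : ℝ) ≤ N := by exact_mod_cast hN
  have hl1 : 0 ≤ Real.log ((N : ℝ) * Fintype.card 𝒳 * K / δ) := by
    refine Real.log_nonneg ?_
    rw [le_div_iff₀ hδ, one_mul]
    refine hδ1.le.trans ?_
    calc (1 : ℝ) = 1 * 1 * 1 := by norm_num
      _ ≤ _ := by gcongr
  have hl2 := (Real.log_pos (one_le_card_mul hX hA hK hH hδ hδ1)).le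
  refine combine_regret_bounds hX' hA' hH' hK' hN' hδ hδ1
    (regret_le_mul M _ πstar hr D) ?_
  have hround : ∀ k : Fin K, value M πstar -
      value M (hopB M.reward N K δ T₁ O₁ POP mle k (past D k)) ≤
      12 * H ^ 2 * value ⟨M.init, M.trans, M.emit, totalBonus N K δ (past D k)⟩
        (hopB M.reward N K δ T₁ O₁ POP mle k (past D k)) := by
    intro k
    refine value_sub_le_totalBonus M πstar _ hH hr N K δ (past D k) (transEst T₁ (past D k))
      (if (k : ℕ) = 0 then O₁ else mle k (past D k)) (hT k) (fun x => ?_) (hPOP _ _ _)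
    split_ifs with hk
    -- In the first round the emission guess is arbitrary, but the bonus is `2` and the discrepancy
    -- at most `1`.
    · have hc : countX (past D k) x = 0 := by
        have : IsEmpty (Fin k) := by rw [hk]; infer_instance
        simp [countX]
      refine (lintegral_tsub_le_one (O₁.lintegral_density x)).trans ?_
      simp [bonusX, bonus, hc]
    · exact hO k (Nat.one_le_iff_ne_zero.2 hk) x
  calc regret M (hopB M.reward N K δ T₁ O₁ POP mle) πstar D
      ≤ ∑ k : Fin K, 12 * (H : ℝ) ^ 2 *
        value ⟨M.init, M.trans, M.emit, totalBonus N K δ (past D k)⟩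
          (hopB M.reward N K δ T₁ O₁ POP mle k (past D k)) :=
        Finset.sum_le_sum fun k _ => hround k
    _ = 12 * (H : ℝ) ^ 2 * ∑ k : Fin K,
        value ⟨M.init, M.trans, M.emit, totalBonus N K δ (past D k)⟩
          (hopB M.reward N K δ T₁ O₁ POP mle k (past D k)) := by rw [Finset.mul_sum]
    _ ≤ _ := by
        refine mul_le_mul_of_nonneg_left (hV.trans ?_) (by positivity)
        have := sum_pathReward_totalBonus_le N δ hl1 hl2 D
        linarith

end Regret

end HOMDP

end

/-! ### The main theorem: a union bound over three failure events. -/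

theorem mainTheorem4 :
    ∃ C : ℝ, 0 < C ∧
      ∀ (𝒳 : Type*) (𝒴 : Type*) (𝒜 : Type*)
        [Fintype 𝒳] [DecidableEq 𝒳] [MeasurableSpace 𝒳] [DiscreteMeasurableSpace 𝒳]
        [Fintype 𝒜] [DecidableEq 𝒜] [MeasurableSpace 𝒜] [DiscreteMeasurableSpace 𝒜]
        [MeasurableSpace 𝒴] (ν : Measure 𝒴) [SigmaFinite ν]
        (H K : ℕ) (δ : ℝ)
        -- the environment, with rewards in [0, 1], and an optimal policy for it
        (M : HOMDP.POMDP 𝒳 𝒜 ν) (πstar : HOMDP.Policy 𝒴 𝒜 H)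
        -- the emission class and the remaining inputs of the algorithm
        (Θ : Finset (HOMDP.Emission 𝒳 ν))
        (T₁ : 𝒳 → 𝒜 → PMF 𝒳) (O₁ : HOMDP.Emission 𝒳 ν)
        (POP : (𝒳 → 𝒜 → PMF 𝒳) → HOMDP.Emission 𝒳 ν → (𝒳 → 𝒜 → ℝ) → HOMDP.Policy 𝒴 𝒜 H)
        (mle : (k : ℕ) → (Fin k → HOMDP.Traj 𝒳 𝒴 𝒜 H) → HOMDP.Emission 𝒳 ν),
        1 ≤ H → 1 ≤ K → 0 < δ → δ < 1 →
        (∀ x a, M.reward x a ∈ Set.Icc (0 : ℝ) 1) →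
        HOMDP.IsOptimal M πstar →
        M.emit ∈ Θ →
        HOMDP.IsPlanner M.init POP →
        (∀ k, 1 ≤ k → ∀ D, HOMDP.IsMLE Θ D (mle k D)) →
        (∀ k, 1 ≤ k → ∀ O ∈ Θ, MeasurableSet {D | mle k D = O}) →
        ENNReal.ofReal (1 - 3 * δ) ≤
          HOMDP.dataLaw M (HOMDP.hopB M.reward Θ.card K δ T₁ O₁ POP mle) K
            {D | HOMDP.regret M (HOMDP.hopB M.reward Θ.card K δ T₁ O₁ POP mle) πstar D ≤
              C * (Real.sqrt ((H : ℝ) ^ 5 * Fintype.card 𝒳 * K *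
                    (Real.log Θ.card +
                      Real.log (2 * (Fintype.card 𝒳 : ℝ) ^ 2 * Fintype.card 𝒜 * K * H / δ))) +
                  Real.sqrt ((H : ℝ) ^ 5 * (Fintype.card 𝒳 : ℝ) ^ 2 * Fintype.card 𝒜 * K *
                    Real.log (2 * (Fintype.card 𝒳 : ℝ) ^ 2 * Fintype.card 𝒜 * K * H / δ)))} := by
  refine ⟨300, by norm_num, ?_⟩
  intro 𝒳 𝒴 𝒜 _ _ _ _ _ _ _ _ _ ν _ H K δ M πstar Θ T₁ O₁ POP mle hH hK hδ hδ1 hr _ hM hPOP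
    hmle hmeas
  set L := HOMDP.hopB M.reward Θ.card K δ T₁ O₁ POP mle
  have hL : L.IsSimple := HOMDP.hopB_isSimple M.reward Θ.card K δ T₁ O₁ POP hmle hmeas
  obtain ⟨y₀⟩ : Nonempty 𝒴 := by
    by_contra h
    have : IsEmpty 𝒴 := not_nonempty_iff.1 h
    have h1 := M.emit.lintegral_density M.init.support_nonempty.some
    rw [lintegral_of_isEmpty] at h1
    exact zero_ne_one h1
  have hA : 1 ≤ Fintype.card 𝒜 := by
    by_contra h
    have : IsEmpty 𝒜 := Fintype.card_eq_zero_iff.1 (by omega)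
    exact this.false
      (πstar.act ⟨0, hH⟩ (fun _ => y₀) fun i => i.elim0).support_nonempty.some
  have hB₁ := HOMDP.dataLaw_transEst_bad_le M hL hA hK hH hδ hδ1 T₁
  have hB₂ := HOMDP.dataLaw_mle_bad_le M hL hK hδ hδ1 hM hmle
  have hB₃ := HOMDP.dataLaw_sum_value_gt_le M hL K hδ (b := 4) (by norm_num) hH
    (fun _ D => HOMDP.totalBonus Θ.card K δ D)
    (fun _ s => HOMDP.totalBonus Θ.card K δ fun l => ((s l).1, fun _ => y₀, (s l).2))
    (fun _ _ => HOMDP.totalBonus_congr _ _ _ rfl)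
    (fun _ D => HOMDP.totalBonus_nonneg _ _ _ D) fun _ D => HOMDP.totalBonus_le _ _ _ D
  have huniv := HOMDP.dataLaw_univ M hL K
  have h3 : ENNReal.ofReal (3 * δ) =
      ENNReal.ofReal δ + ENNReal.ofReal δ + ENNReal.ofReal δ := by
    rw [← ENNReal.ofReal_add hδ.le hδ.le, ← ENNReal.ofReal_add (by positivity) hδ.le]
    congr 1
    ring
  rw [ENNReal.ofReal_sub _ (by positivity), ENNReal.ofReal_one, tsub_le_iff_right, ← huniv, h3]
  -- Subadditivity suffices here, so the regret event need not be measurable.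
  refine (measure_univ_le_add_compl _).trans (add_le_add le_rfl ?_)
  refine (measure_mono fun D hD => ?_).trans ((measure_union_le _ _).trans
    (add_le_add ((measure_union_le _ _).trans (add_le_add hB₁ hB₂)) hB₃))
  by_contra hgood
  simp only [Set.mem_union, Set.mem_ofPred_eq, not_or, not_exists, not_and, not_lt] at hgood
  exact hD (HOMDP.hopB_regret_le δ M πstar Θ.card T₁ O₁ POP mle
    (Finset.card_pos.2 ⟨_, hM⟩) hA hH hK hδ hδ1 hr hPOP D hgood.1.1 hgood.1.2 hgood.2)
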